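/- **Setting.** Fix finitely many cores, a finite set $\mathbb O$ of operations, a finite set of stages, and finitely many predicate symbols with arities. A program $\mathcal P$ assigns to each core $c$ a finite word $\mathcal I_c$ over $\mathbb O$. Its instructions are the triples $(c,j,\mathcal I_c[j])$ with label $0\le j<|\mathcal I_c|$; its events are the pairs $i.st$ of an instruction $i$ of $\mathcal P$ and a stage $st$. Write $i<_r i'$ if $i,i'$ are on the same core and $i$ has the smaller label. A *$\mu$hb graph* of $\mathcal P$ is a directed acyclic graph $G=(V,E)$ whose node set $V$ is the set of events of $\mathcal P$. An axiomatic semantics $\mathcal A$ consists of an interpretation $\mathsf P^{\mathcal A}\subseteq\mathbb O^k$ of each $k$-ary predicate symbol $\mathsf P$ and finitely many axioms. An axiom is a sentence $Q_1 i_1\cdots Q_k i_k\,\phi$ with quantifiers $Q_m\in\{\forall,\exists\}$ and $\phi$ a Boolean combination of atoms $i<_r i'$, $\mathsf{hb}(i.st,i'.st')$ and $\mathsf P(i_1,\dots,i_m)$. In a graph $G$ of $\mathcal P$, the quantifiers range over instructions of $\mathcal P$ different from those already assigned to other variables, $\mathsf{hb}$ is interpreted as the transitive closure $E^+$, and $\mathsf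 P$ by applying $\mathsf P^{\mathcal A}$ to the operations. $G$ is *valid* ($G\models_{\mathcal P}\mathcal A$) if it is a $\mu$hb graph of $\mathcal P$ that satisfies all axioms. * $\mathcal A$ is *universal* if all quantifiers in its axioms are $\forall$. * $\mathcal A$ is *refinable* if, whenever $G=(V,E)\models_{\mathcal P}\mathcal A$ and $G'=(V,E')$ is a $\mu$hb graph of $\mathcal P$ with $E^+\subseteq E'^+$ and $E'^+$ total on $V$, then $G'\models_{\mathcal P}\mathcal A$. * $\mathcal A$ is *extensible* if for each of its axioms $ax$, all programs $\mathcal P'\preceq\mathcal P$ (corewise prefix) with residual program $\mathcal P''$ (the corewise remaining suffixes), and all $\mu$hb graphs $G'$ of $\mathcal P'$ and $G''$ of $\mathcal P''$: if $G'\models_{\mathcal P'}ax$ and $G''\models_{\mathcal P''}ax$, then $G'\triangleright G''\models_{\mathcal P}ax$. Here the instructions of $\mathcal P''$ are identified with the instructions of $\mathcal P$ outside $\mathcal P'$, and $G'\triangleright G''$ is the union of the two graphs with an added edge from every sink of $G'$ to every source of $G''$. A *linearization* of a $\mu$hb graph $G$ is a sequence (trace) that lists every node of $G$ exactly once, in an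 order compatible with $E^+$. For a trace $\sigma$ let $\mathsf{start}(i)$ and $\mathsf{end}(i)$ be the first and last position of an event of $i$, and $\mathsf{pfxend}(i)$ the maximum of $\mathsf{end}(i')$ over $i'\le_r i$; $i_1,i_2$ are *coupled* if the intervals $[\mathsf{start}(i_1),\mathsf{pfxend}(i_1)]$ and $[\mathsf{start}(i_2),\mathsf{pfxend}(i_2)]$ intersect. $\sigma$ is *$t$-reordering bounded* if for all instructions $i_1,i_2$ on the same core, with labels $\lambda_1,\lambda_2$: (1) if some event of $i_2$ precedes some event of $i_1$ in $\sigma$, then $\lambda_2-\lambda_1<t$; and (2) if some instruction $i$ (on any core) is coupled with both $i_1$ and $i_2$, then $|\lambda_1-\lambda_2|<t$. An *operational model* $\mathcal M$ has a set of control states, an initial state, an absorbing final state, a history parameter $h\in\mathbb N\cup\{\infty\}$, and transitions $(q,r,q',a)$, where $r$ gives for each core the instruction under its head or an end marker. Each core has a read-only input tape carrying its instruction stream, initially with the head at the left end. The action $a$ moves the head of a core one instruction to the right (possible only if there is an instruction under it), does nothing, emits the event $i.st$ for the $n$-th instruction $i$ to the left of the head of a core, or removes the $n$-th instruction to the left of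 the head of a core. In every configuration of a run at most $h$ instructions are to the left of each head. $\mathsf{Traces}_{\mathcal M}(\mathcal P)$ is the set of sequences of events emitted by the runs on $\mathcal P$ that end in the final state. $\mathcal M$ is *sound* for $\mathcal A$ if for every program $\mathcal P$ each element of $\mathsf{Traces}_{\mathcal M}(\mathcal P)$ is a linearization of some $G\models_{\mathcal P}\mathcal A$. $\mathcal M$ is *$t$-complete* for $\mathcal A$ if for every $\mathcal P$ and every $G\models_{\mathcal P}\mathcal A$, $\mathsf{Traces}_{\mathcal M}(\mathcal P)$ contains all $t$-reordering bounded linearizations of $G$. **Theorem.** There is an algorithm (a computable function) that takes as input a finite description of an axiomatic semantics $\mathcal A$ (its cores, operations, stages, interpreted predicates and axioms) and a number $t\in\mathbb N$, and outputs a finite description of an operational model, such that the following holds. If $\mathcal A$ is universal, refinable and extensible, then the output describes an operational model with finitely many control states and bounded history ($h\in\mathbb N$) that is sound and $t$-complete for $\mathcal A$; its transition table refers to the instructions under the heads only through their operations. -/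

import Mathlib

namespace MuSpec

/-! ### Signatures, instructions, programs -/

/-- The parameters of a μspec model: finitely many cores, operations, stages and predicate symbols
(with arities). -/
structure Sig where
  numCores : ℕ
  numOps : ℕ
  numStages : ℕ
  numPreds : ℕ
  arity : Fin numPreds → ℕ

abbrev Sig.Core (S : Sig) : Type := Fin S.numCores
abbrev Sig.Op (S : Sig) : Type := Fin S.numOps
abbrev Sig.Stage (S : Sig) : Type := Fin S.numStages
abbrev Sig.Pred (S : Sig) : Type := Fin S.numPreds

/-- An instruction `(c, j, o)`: core, label (index in the instruction stream), operation. -/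
structure Instr (S : Sig) where
  core : S.Core
  label : ℕ
  op : S.Op

/-- The event `i.st`: the instruction `i` performing in the stage `st`. -/
structure Event (S : Sig) where
  instr : Instr S
  stage : S.Stage

/-- A program: one instruction stream (word over the operations) per core. -/
abbrev Program (S : Sig) : Type := S.Core → List S.Op

/-- The instructions occurring in a program. -/
def Program.instrs {S : Sig} (P : Program S) : Set (Instr S) :=
  {i | (P i.core)[i.label]? = some i.op}

/-- The events of a program. -/
def Program.events {S : Sig} (P : Program S) : Set (Event S) :=
  {e | e.instr ∈ P.instrs}

/-- The reference order `<_r`: same core, smaller label. -/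
def Instr.RefLT {S : Sig} (i j : Instr S) : Prop := i.core = j.core ∧ i.label < j.label

/-- `≤_r`, the reflexive version of the reference order on the instructions of one program. -/
def Instr.RefLE {S : Sig} (i j : Instr S) : Prop := i = j ∨ i.RefLT j

/-! ### Syntax of axioms -/

/-- Quantifier-free formulas over `k` instruction variables. -/
inductive QF (S : Sig) (k : ℕ) : Type where
  | ref (i j : Fin k) : QF S k
  | hb (i : Fin k) (st : S.Stage) (j : Fin k) (st' : S.Stage) : QF S k
  | pred (p : S.Pred) (args : Fin (S.arity p) → Fin k) : QF S k
  | and (φ ψ : QF S k) : QF S k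
  | or (φ ψ : QF S k) : QF S k
  | not (φ : QF S k) : QF S k

/-- Axioms in prenex form with `k` free variables; a quantifier binds the last variable of its
body. `Ax S 0` consists of the sentences. -/
inductive Ax (S : Sig) : ℕ → Type where
  | qf {k : ℕ} (φ : QF S k) : Ax S k
  | all {k : ℕ} (ψ : Ax S (k + 1)) : Ax S k
  | ex {k : ℕ} (ψ : Ax S (k + 1)) : Ax S k

/-- Universal axioms: `∀ i₁ ⋯ ∀ iₖ, φ` with `φ` quantifier-free. -/
def Ax.IsUniversal {S : Sig} : {k : ℕ} → Ax S k → Prop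
  | _, .qf _ => True
  | _, .all ψ => ψ.IsUniversal
  | _, .ex _ => False

/-- An axiomatic semantics: an interpretation of the predicate symbols over the operations,
and finitely many axioms. -/
structure Semantics (S : Sig) where
  interp : (p : S.Pred) → Finset (Fin (S.arity p) → S.Op)
  axs : List (Ax S 0)

/-! ### Graphs and satisfaction -/

/-- A directed graph on events. -/
structure EventGraph (S : Sig) where
  V : Set (Event S)
  E : Event S → Event S → Prop

/-- `E⁺`, the transitive closure of the edge relation. -/
def EventGraph.Hb {S : Sig} (G : EventGraph S) : Event S → Event S → Prop :=
  Relation.TransGen G.E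

/-- `G` is a μhb graph of the program `P`: a directed acyclic graph on the events of `P`. -/
structure EventGraph.IsHbGraph {S : Sig} (G : EventGraph S) (P : Program S) : Prop where
  nodes : G.V = P.events
  edges : ∀ a b, G.E a b → a ∈ G.V ∧ b ∈ G.V
  acyclic : ∀ a, ¬ G.Hb a a

def QF.Sat {S : Sig} (A : Semantics S) (G : EventGraph S) {k : ℕ} (s : Fin k → Instr S) :
    QF S k → Prop
  | .ref i j => (s i).RefLT (s j)
  | .hb i st j st' => G.Hb ⟨s i, st⟩ ⟨s j, st'⟩
  | .pred p args => (fun m => (s (args m)).op) ∈ A.interp p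
  | .and φ ψ => φ.Sat A G s ∧ ψ.Sat A G s
  | .or φ ψ => φ.Sat A G s ∨ ψ.Sat A G s
  | .not φ => ¬ φ.Sat A G s

/-- Satisfaction of an axiom; quantifiers range over the instructions of `P` that are not yet
assigned to another variable. -/
def Ax.Sat {S : Sig} (A : Semantics S) (P : Program S) (G : EventGraph S) :
    {k : ℕ} → Ax S k → (Fin k → Instr S) → Prop
  | _, .qf φ, s => φ.Sat A G s
  | k, .all ψ, s => ∀ i ∈ P.instrs, i ∉ Set.range s →
      ψ.Sat A P G (Fin.snoc (α := fun _ : Fin (k + 1) => Instr S) s i)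
  | k, .ex ψ, s => ∃ i ∈ P.instrs, i ∉ Set.range s ∧
      ψ.Sat A P G (Fin.snoc (α := fun _ : Fin (k + 1) => Instr S) s i)

/-- `G ⊨_P ax` for a sentence `ax`. -/
def Semantics.Models {S : Sig} (A : Semantics S) (P : Program S) (G : EventGraph S)
    (ax : Ax S 0) : Prop :=
  ax.Sat A P G Fin.elim0

/-- `G` is a μhb graph of `P` that satisfies all axioms. -/
def Semantics.Valid {S : Sig} (A : Semantics S) (P : Program S) (G : EventGraph S) : Prop :=
  G.IsHbGraph P ∧ ∀ ax ∈ A.axs, A.Models P G ax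

/-- All axioms are universal. -/
def Semantics.IsUniversal {S : Sig} (A : Semantics S) : Prop :=
  ∀ ax ∈ A.axs, ax.IsUniversal

/-! ### Refinability -/

/-- `G ⊑ G'`. -/
def EventGraph.Refines {S : Sig} (G G' : EventGraph S) : Prop :=
  G.V = G'.V ∧ ∀ a b, G.Hb a b → G'.Hb a b

/-- Any two distinct nodes are ordered by the transitive closure of the edge relation. -/
def EventGraph.IsLinear {S : Sig} (G : EventGraph S) : Prop :=
  ∀ a ∈ G.V, ∀ b ∈ G.V, a ≠ b → G.Hb a b ∨ G.Hb b a

/-- All linear μhb graphs refining a valid μhb graph are valid. -/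
def Semantics.Refinable {S : Sig} (A : Semantics S) : Prop :=
  ∀ (P : Program S) (G : EventGraph S), A.Valid P G →
    ∀ G' : EventGraph S, G'.IsHbGraph P → G'.IsLinear → G.Refines G' → A.Valid P G'

/-! ### Extensibility -/

/-- `P' ≼ P`: every stream of `P'` is a prefix of the corresponding stream of `P`. -/
def Program.IsPrefix {S : Sig} (P' P : Program S) : Prop := ∀ c, P' c <+: P c

/-- The residual program `P ⊘ P'`. -/
def Program.residual {S : Sig} (P P' : Program S) : Program S :=
  fun c => (P c).drop (P' c).length

/-- Shift the label of an event on core `c` by `d c`. -/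
def Event.shift {S : Sig} (d : S.Core → ℕ) (e : Event S) : Event S :=
  ⟨⟨e.instr.core, e.instr.label + d e.instr.core, e.instr.op⟩, e.stage⟩

/-- Transport of a graph along a shift of the labels. -/
def EventGraph.shift {S : Sig} (d : S.Core → ℕ) (G : EventGraph S) : EventGraph S where
  V := Event.shift d '' G.V
  E := Relation.Map G.E (Event.shift d) (Event.shift d)

def EventGraph.sink {S : Sig} (G : EventGraph S) : Set (Event S) :=
  {a | a ∈ G.V ∧ ∀ b, ¬ G.E a b}

def EventGraph.source {S : Sig} (G : EventGraph S) : Set (Event S) :=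
  {b | b ∈ G.V ∧ ∀ a, ¬ G.E a b}

/-- The sequential composition `G' ▷ G''`. -/
def EventGraph.comp {S : Sig} (G' G'' : EventGraph S) : EventGraph S where
  V := G'.V ∪ G''.V
  E a b := G'.E a b ∨ G''.E a b ∨ (a ∈ G'.sink ∧ b ∈ G''.source)

/-- Extensibility of an axiom. The residual program numbers its instructions from `0`, so its graph
is moved to the labels that these instructions have in `P` before it is composed. -/
def Semantics.AxExtensible {S : Sig} (A : Semantics S) (ax : Ax S 0) : Prop :=
  ∀ P P' : Program S, P'.IsPrefix P → ∀ G' G'' : EventGraph S,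
    G'.IsHbGraph P' → G''.IsHbGraph (P.residual P') →
    A.Models P' G' ax → A.Models (P.residual P') G'' ax →
    A.Models P (G'.comp (G''.shift fun c => (P' c).length)) ax

def Semantics.Extensible {S : Sig} (A : Semantics S) : Prop :=
  ∀ ax ∈ A.axs, A.AxExtensible ax

/-! ### Traces, linearizations, reordering bounds -/

/-- `a` occurs before `b` in the trace `τ`. -/
def Precedes {S : Sig} (τ : List (Event S)) (a b : Event S) : Prop :=
  ∃ i j : ℕ, i < j ∧ τ[i]? = some a ∧ τ[j]? = some b

/-- `τ` enumerates the nodes of `G` without repetition, in an order that respects `G`. -/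
def IsLinearization {S : Sig} (τ : List (Event S)) (G : EventGraph S) : Prop :=
  τ.Nodup ∧ (∀ e, e ∈ τ ↔ e ∈ G.V) ∧ ∀ a b, G.Hb a b → Precedes τ a b

/-- The positions in `τ` of the events of the instruction `i`. -/
def positions {S : Sig} (τ : List (Event S)) (i : Instr S) : Set ℕ :=
  {p | ∃ st : S.Stage, τ[p]? = some ⟨i, st⟩}

/-- `start(i) = p`: `p` is the first position of an event of `i`. -/
def IsStart {S : Sig} (τ : List (Event S)) (i : Instr S) (p : ℕ) : Prop :=
  IsLeast (positions τ i) p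

/-- `end(i) = p`: `p` is the last position of an event of `i`. -/
def IsEnd {S : Sig} (τ : List (Event S)) (i : Instr S) (p : ℕ) : Prop :=
  IsGreatest (positions τ i) p

/-- `pfxend(i) = p`: `p` is the maximum of `end(i')` over the instructions `i' ≤_r i`. -/
def IsPfxEnd {S : Sig} (τ : List (Event S)) (i : Instr S) (p : ℕ) : Prop :=
  IsGreatest {q | ∃ i' : Instr S, i'.RefLE i ∧ IsEnd τ i' q} p

/-- `coup(i₁, i₂)`: the intervals `[start(i₁), pfxend(i₁)]` and `[start(i₂), pfxend(i₂)]`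
overlap. -/
def Coupled {S : Sig} (τ : List (Event S)) (i₁ i₂ : Instr S) : Prop :=
  ∃ s₁ e₁ s₂ e₂ : ℕ, IsStart τ i₁ s₁ ∧ IsPfxEnd τ i₁ e₁ ∧ IsStart τ i₂ s₂ ∧ IsPfxEnd τ i₂ e₂ ∧
    (Set.Icc s₁ e₁ ∩ Set.Icc s₂ e₂).Nonempty

/-- `diff_r(i₁, i₂)`. -/
def diffR {S : Sig} (i₁ i₂ : Instr S) : ℤ := (i₂.label : ℤ) - (i₁.label : ℤ)

/-- `τ` is a `t`-reordering bounded trace. -/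
def ReorderBounded {S : Sig} (t : ℕ) (τ : List (Event S)) : Prop :=
  ∀ i₁ i₂ : Instr S, i₁.core = i₂.core →
    (∀ st₁ st₂ : S.Stage, Precedes τ ⟨i₂, st₂⟩ ⟨i₁, st₁⟩ → diffR i₁ i₂ < t) ∧
    (∀ i : Instr S, Coupled τ i₁ i → Coupled τ i i₂ → |diffR i₁ i₂| < t)

/-! ### Operational models -/

/-- Actions. `sched c i st` and `drop c i` refer to the `i`-th instruction to the left of the head
of core `c`, where `i = 0` is the instruction next to the head. -/
inductive Act (S : Sig) : Type where
  | right (c : S.Core) : Act S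
  | stay : Act S
  | sched (c : S.Core) (i : ℕ) (st : S.Stage) : Act S
  | drop (c : S.Core) (i : ℕ) : Act S

/-- The history indices used by an action are smaller than the history parameter. -/
def Act.InHistory {S : Sig} (h : ℕ∞) : Act S → Prop
  | .right _ => True
  | .stay => True
  | .sched _ i _ => (i : ℕ∞) < h
  | .drop _ i => (i : ℕ∞) < h

/-- An operational model with control states `Q`. The second component of a transition is what
the heads read; `none` stands for the end of the stream. -/
structure OpModel (S : Sig) (Q : Type) where
  hist : ℕ∞
  trans : Set (Q × (S.Core → Option (Instr S)) × Q × Act S)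
  init : Q
  final : Q
  act_mem : ∀ q r q' a, (q, r, q', a) ∈ trans → a.InHistory hist
  absorbing : ∀ r q' a, (final, r, q', a) ∈ trans → q' = final

/-- A finite set of control states. -/
def OpModel.FiniteState {S : Sig} {Q : Type} (_M : OpModel S Q) : Prop := Finite Q

def OpModel.BoundedHistory {S : Sig} {Q : Type} (M : OpModel S Q) : Prop := M.hist ≠ ⊤

/-- A configuration `(U, q, V)`. `V c` is the tape content to the right of the head of core `c`
and `U c` the one to its left; both are listed starting from the head. -/
structure Config (S : Sig) (Q : Type) where
  U : S.Core → List (Instr S)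
  q : Q
  V : S.Core → List (Instr S)

def OpModel.Allowed {S : Sig} {Q : Type} (M : OpModel S Q) (γ : Config S Q) : Prop :=
  ∀ c, ((γ.U c).length : ℕ∞) ≤ M.hist

/-- `a.Effect U V e U' V'`: the action `a` turns the tape contents `U`, `V` into `U'`, `V'` and
emits `e` (`none` for a silent action). -/
inductive Act.Effect {S : Sig} : Act S → (S.Core → List (Instr S)) → (S.Core → List (Instr S)) →
    Option (Event S) → (S.Core → List (Instr S)) → (S.Core → List (Instr S)) → Prop
  | right (c : S.Core) (i : Instr S) (w : List (Instr S)) (U V : S.Core → List (Instr S))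
      (hV : V c = i :: w) :
      Effect (.right c) U V none (Function.update U c (i :: U c)) (Function.update V c w)
  | stay (U V : S.Core → List (Instr S)) : Effect .stay U V none U V
  | sched (c : S.Core) (n : ℕ) (st : S.Stage) (i : Instr S) (U V : S.Core → List (Instr S))
      (hU : (U c)[n]? = some i) :
      Effect (.sched c n st) U V (some ⟨i, st⟩) U V
  | drop (c : S.Core) (n : ℕ) (U V : S.Core → List (Instr S)) (hU : n < (U c).length) :
      Effect (.drop c n) U V none (Function.update U c ((U c).eraseIdx n)) V

/-- One step between configurations, by a transition that is enabled. -/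
def OpModel.Step {S : Sig} {Q : Type} (M : OpModel S Q) (γ : Config S Q) (e : Option (Event S))
    (γ' : Config S Q) : Prop :=
  ∃ a : Act S, (γ.q, (fun c => (γ.V c).head?), γ'.q, a) ∈ M.trans ∧
    a.Effect γ.U γ.V e γ'.U γ'.V

/-- Runs through allowed configurations, with the sequence of emitted events. -/
inductive OpModel.Run {S : Sig} {Q : Type} (M : OpModel S Q) :
    Config S Q → List (Event S) → Config S Q → Prop
  | nil (γ : Config S Q) (hγ : M.Allowed γ) : Run M γ [] γ
  | cons (γ γ' γ'' : Config S Q) (e : Option (Event S)) (τ : List (Event S))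
      (hγ : M.Allowed γ) (hstep : M.Step γ e γ') (hrun : Run M γ' τ γ'') :
      Run M γ (e.toList ++ τ) γ''

/-- The initial configuration on the program `P`. -/
def OpModel.initConfig {S : Sig} {Q : Type} (M : OpModel S Q) (P : Program S) : Config S Q where
  U := fun _ => []
  q := M.init
  V := fun c => (P c).mapIdx fun j o => ⟨c, j, o⟩

/-- The traces of the accepting runs of `M` on `P`. -/
def OpModel.traces {S : Sig} {Q : Type} (M : OpModel S Q) (P : Program S) :
    Set (List (Event S)) :=
  {τ | ∃ γ : Config S Q, M.Run (M.initConfig P) τ γ ∧ γ.q = M.final}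

/-- Soundness with respect to `A`. -/
def OpModel.Sound {S : Sig} {Q : Type} (M : OpModel S Q) (A : Semantics S) : Prop :=
  ∀ P : Program S, ∀ τ ∈ M.traces P, ∃ G : EventGraph S, A.Valid P G ∧ IsLinearization τ G

/-- `t`-completeness with respect to `A`. -/
def OpModel.TComplete {S : Sig} {Q : Type} (t : ℕ) (M : OpModel S Q) (A : Semantics S) : Prop :=
  ∀ (P : Program S) (G : EventGraph S), A.Valid P G →
    ∀ τ : List (Event S), IsLinearization τ G → ReorderBounded t τ → τ ∈ M.traces P

/-! ### Finite descriptions, as input and output of the synthesis procedure -/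

/-- A symbol of a formula: a tag and its parameters. -/
abbrev Token : Type := ℕ × List ℕ

/-- Formulas in postfix notation. -/
def QF.code {S : Sig} {k : ℕ} : QF S k → List Token
  | .ref i j => [(0, [i.val, j.val])]
  | .hb i st j st' => [(1, [i.val, st.val, j.val, st'.val])]
  | .pred p args => [(2, p.val :: List.ofFn fun m => (args m).val)]
  | .and φ ψ => φ.code ++ ψ.code ++ [(3, [])]
  | .or φ ψ => φ.code ++ ψ.code ++ [(4, [])]
  | .not φ => φ.code ++ [(5, [])]

/-- Axioms: the list of quantifiers, followed by the matrix. -/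
def Ax.code {S : Sig} : {k : ℕ} → Ax S k → List Token
  | _, .qf φ => φ.code
  | _, .all ψ => (6, []) :: ψ.code
  | _, .ex ψ => (7, []) :: ψ.code

/-- The numbers of cores, operations and stages; for each predicate symbol its arity and the truth
table of its interpretation; the axioms. -/
abbrev SemCode : Type := (ℕ × ℕ × ℕ) × List (ℕ × List Bool) × List (List Token)

def Semantics.code {S : Sig} (A : Semantics S) : SemCode :=
  ((S.numCores, S.numOps, S.numStages),
    List.ofFn (fun p : S.Pred => (S.arity p,
      List.ofFn fun x : Fin (S.numOps ^ S.arity p) =>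
        decide (finFunctionFinEquiv.symm x ∈ A.interp p))),
    A.axs.map Ax.code)

def Act.code {S : Sig} : Act S → ℕ × List ℕ
  | .right c => (0, [c.val])
  | .stay => (1, [])
  | .sched c i st => (2, [c.val, i, st.val])
  | .drop c i => (3, [c.val, i])

/-- Number of control states, history parameter, initial state, final state, and a finite table of
transitions whose guards are operations or the end of the stream. -/
abbrev ModelCode : Type :=
  (ℕ × ℕ × ℕ × ℕ) × List (ℕ × List (Option ℕ) × ℕ × (ℕ × List ℕ))

/-- `m` describes `M`: the history parameter is the number in `m`, and a transition belongs to `M`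
iff the table of `m` lists it, where of each instruction under a head only the operation is
recorded. -/
def OpModel.HasCode {S : Sig} {N : ℕ} (M : OpModel S (Fin N)) (m : ModelCode) : Prop :=
  ∃ h : ℕ, M.hist = h ∧ m.1 = (N, h, M.init.val, M.final.val) ∧
    ∀ (q : Fin N) (r : S.Core → Option (Instr S)) (q' : Fin N) (a : Act S),
      (q, r, q', a) ∈ M.trans ↔
        (q.val, List.ofFn (fun c => (r c).map fun i => i.op.val), q'.val, a.code) ∈ m.2

end MuSpec

/-! A repetition-free trace listing exactly the events of a program is itself a linear graph,
`traceGraph`, whose happens-before relation is the order of the trace. It suffices to build a model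
that accepts an emitted trace exactly when this graph satisfies the axioms. Soundness is then
immediate. For completeness, refinability makes the linear graph of any linearization of a valid
graph valid (`Semantics.Refinable.valid_traceGraph`), so it remains to emit every reordering bounded
trace with a bounded history.

Finite control: a universal axiom with `n` quantifiers fails iff some `n` distinct instructions
violate its matrix (`Ax.IsUniversal.exists_matrix_sentence`), and the matrix depends only on the
cores, operations and fetch order of these instructions and on the order of their events. This is
what a thread records. A control state holds the threads of all small sets of fetched instructions:
a subset construction for the machine that guesses the instructions of a violation. Labels are
unbounded, but to see which pick a scheduling action concerns, its age capped at `t + 1` is enough: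
only the oldest entry of a full history is ever dropped, so the `n`-th entry is the fetched
instruction of age `n`. `Represents.fetch` and `Represents.sched` show that a control state
determines its successors, and `Represents.accepting_iff` that, once everything is fetched, it
decides whether the trace is good.

Bounded history: instructions are fetched only on demand. If the next event belongs to an unfetched
instruction `i`, the reordering bound says that the remaining events on that core have labels at
least `i.label - t`, so a window of `t + 1` instructions loses nothing that is still needed
(`exists_run`).

Computability: only finitely many repetition-free control states can occur, so a list of states
closed under the steps exists (`exists_closedUnder`). Closedness is primitive recursive, hence an
unbounded search finds such a list. Correctness is proved for every closed list, so nothing more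
need be known about the one found. -/

namespace MuSpec

/-! ### Primitive recursive functions -/

/-- The elements of a list, without repetitions. -/
def nub {β : Type*} [DecidableEq β] (l : List β) : List β := l ∪ []

theorem mem_nub {β : Type*} [DecidableEq β] {l : List β} {b : β} : b ∈ nub l ↔ b ∈ l := by
  simp [nub]

theorem nodup_nub {β : Type*} [DecidableEq β] (l : List β) : (nub l).Nodup :=
  List.Nodup.union l List.nodup_nil

section Primrec

variable {α β γ σ : Type*} [Primcodable α] [Primcodable β] [Primcodable γ] [Primcodable σ]

-- The closure properties below are stated for functions of a common parameter, so that `fun_prop`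
-- can assemble proofs of primitive recursiveness by composition.
attribute [fun_prop] Primrec Primrec.id Primrec.const Primrec.comp

@[fun_prop]
theorem primrec_fst {f : α → β × γ} (h : Primrec f) : Primrec fun a => (f a).1 :=
  Primrec.fst.comp h

@[fun_prop]
theorem primrec_snd {f : α → β × γ} (h : Primrec f) : Primrec fun a => (f a).2 :=
  Primrec.snd.comp h

@[fun_prop]
theorem primrec_mk {f : α → β} {g : α → γ} (hf : Primrec f) (hg : Primrec g) :
    Primrec fun a => (f a, g a) :=
  hf.pair hg

@[fun_prop]
theorem primrec_some {f : α → β} (hf : Primrec f) : Primrec fun a => some (f a) :=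
  Primrec.option_some.comp hf

@[fun_prop]
theorem primrec_toList {f : α → Option β} (hf : Primrec f) : Primrec fun a => (f a).toList :=
  Primrec.optionToList.comp hf

@[fun_prop]
theorem primrec_optionMap {f : α → Option β} {g : α → β → σ} (hf : Primrec f)
    (hg : Primrec fun p : α × β => g p.1 p.2) : Primrec fun a => (f a).map (g a) :=
  Primrec.option_map hf hg

@[fun_prop]
theorem primrec_add {f g : α → ℕ} (hf : Primrec f) (hg : Primrec g) :
    Primrec fun a => f a + g a :=
  Primrec.nat_add.comp hf hg

@[fun_prop]
theorem primrec_mul {f g : α → ℕ} (hf : Primrec f) (hg : Primrec g) :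
    Primrec fun a => f a * g a :=
  Primrec.nat_mul.comp hf hg

@[fun_prop]
theorem primrec_min {f g : α → ℕ} (hf : Primrec f) (hg : Primrec g) :
    Primrec fun a => min (f a) (g a) :=
  Primrec.nat_min.comp hf hg

@[fun_prop]
theorem primrec_max {f g : α → ℕ} (hf : Primrec f) (hg : Primrec g) :
    Primrec fun a => max (f a) (g a) :=
  Primrec.nat_max.comp hf hg

@[fun_prop]
theorem primrec_lt {f g : α → ℕ} (hf : Primrec f) (hg : Primrec g) :
    Primrec fun a => decide (f a < g a) :=
  (Primrec.nat_lt.comp hf hg).decide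

@[fun_prop]
theorem primrec_eq {f g : α → β} [∀ a, Decidable (f a = g a)] (hf : Primrec f)
    (hg : Primrec g) : Primrec fun a => decide (f a = g a) :=
  (Primrec.eq.comp hf hg).decide

@[fun_prop]
theorem primrec_and {f g : α → Bool} (hf : Primrec f) (hg : Primrec g) :
    Primrec fun a => f a && g a :=
  Primrec.and.comp hf hg

@[fun_prop]
theorem primrec_or {f g : α → Bool} (hf : Primrec f) (hg : Primrec g) :
    Primrec fun a => f a || g a :=
  Primrec.or.comp hf hg

@[fun_prop]
theorem primrec_not {f : α → Bool} (hf : Primrec f) : Primrec fun a => !f a :=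
  Primrec.not.comp hf

@[fun_prop]
theorem primrec_ite {c : α → Prop} [DecidablePred c] {f g : α → β}
    (hc : Primrec fun a => decide (c a)) (hf : Primrec f) (hg : Primrec g) :
    Primrec fun a => if c a then f a else g a :=
  Primrec.ite (Primrec.primrecPred hc) hf hg

@[fun_prop]
theorem primrec_cons {f : α → β} {g : α → List β} (hf : Primrec f) (hg : Primrec g) :
    Primrec fun a => f a :: g a :=
  Primrec.list_cons.comp hf hg

@[fun_prop]
theorem primrec_append {f g : α → List β} (hf : Primrec f) (hg : Primrec g) :
    Primrec fun a => f a ++ g a :=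
  Primrec.list_append.comp hf hg

@[fun_prop]
theorem primrec_map {f : α → List β} {g : α → β → σ} (hf : Primrec f)
    (hg : Primrec fun p : α × β => g p.1 p.2) : Primrec fun a => (f a).map (g a) :=
  Primrec.list_map hf hg

@[fun_prop]
theorem primrec_flatMap {f : α → List β} {g : α → β → List σ} (hf : Primrec f)
    (hg : Primrec fun p : α × β => g p.1 p.2) : Primrec fun a => (f a).flatMap (g a) :=
  Primrec.list_flatMap hf hg

@[fun_prop]
theorem primrec_foldl {f : α → List β} {g : α → σ} {h : α → σ → β → σ} (hf : Primrec f)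
    (hg : Primrec g) (hh : Primrec fun p : α × σ × β => h p.1 p.2.1 p.2.2) :
    Primrec fun a => (f a).foldl (h a) (g a) :=
  Primrec.list_foldl (h := fun a p => h a p.1 p.2) hf hg hh

@[fun_prop]
theorem primrec_foldr {f : α → List β} {g : α → σ} {h : α → β → σ → σ} (hf : Primrec f)
    (hg : Primrec g) (hh : Primrec fun p : α × β × σ => h p.1 p.2.1 p.2.2) :
    Primrec fun a => (f a).foldr (h a) (g a) :=
  Primrec.list_foldr (h := fun a p => h a p.1 p.2) hf hg hh

@[fun_prop]
theorem primrec_length {f : α → List β} (hf : Primrec f) : Primrec fun a => (f a).length :=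
  Primrec.list_length.comp hf

@[fun_prop]
theorem primrec_range {f : α → ℕ} (hf : Primrec f) : Primrec fun a => List.range (f a) :=
  Primrec.list_range.comp hf

@[fun_prop]
theorem primrec_getD {f : α → List β} {g : α → ℕ} (d : β) (hf : Primrec f) (hg : Primrec g) :
    Primrec fun a => (f a).getD (g a) d :=
  (Primrec.list_getD d).comp hf hg

@[fun_prop]
theorem primrec_tail {f : α → List β} (hf : Primrec f) : Primrec fun a => (f a).tail :=
  Primrec.list_tail.comp hf

@[fun_prop]
theorem primrec_idxOf [BEq β] [LawfulBEq β] {f : α → β} {g : α → List β} (hf : Primrec f)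
    (hg : Primrec g) : Primrec fun a => (g a).idxOf (f a) := by
  classical
  refine (Primrec.list_idxOf.comp hf hg).of_eq fun a => ?_
  congr
  -- Lawful Boolean equality is unique, so the result does not depend on the instance used for
  -- `idxOf`.
  exact lawful_beq_subsingleton _ _

@[fun_prop]
theorem primrec_mem {f : α → β} {g : α → List β} [∀ a, Decidable (f a ∈ g a)] (hf : Primrec f)
    (hg : Primrec g) : Primrec fun a => decide (f a ∈ g a) := by
  classical
  exact (primrec_lt (primrec_idxOf hf hg) (primrec_length hg)).of_eq fun a => by
    simp [List.idxOf_lt_length_iff]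

@[fun_prop]
theorem primrec_all {f : α → List β} {g : α → β → Bool} (hf : Primrec f)
    (hg : Primrec fun p : α × β => g p.1 p.2) : Primrec fun a => (f a).all (g a) := by
  have h : Primrec fun a => (f a).foldr (fun b r => g a b && r) true :=
    primrec_foldr hf (.const true)
      (Primrec.and.comp (hg.comp (Primrec.fst.pair (Primrec.fst.comp Primrec.snd)))
        (Primrec.snd.comp Primrec.snd))
  exact h.of_eq fun a => by induction f a <;> simp_all

@[fun_prop]
theorem primrec_nub [DecidableEq β] {f : α → List β} (hf : Primrec f) :
    Primrec fun a => nub (f a) := by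
  have h : Primrec fun a => (f a).foldr (fun b l => if b ∈ l then l else b :: l) [] :=
    primrec_foldr hf (.const []) (by fun_prop)
  exact h.of_eq fun a => by
    unfold nub
    induction f a with
    | nil => rfl
    | cons b l ih => rw [List.cons_union, ← ih]; simp [List.insert]

/-- A total search for a witness of a decidable relation is computable. -/
theorem exists_computable_choice {p : α → β → Bool} (hp : Primrec fun q : α × β => p q.1 q.2)
    (h : ∀ a, ∃ b, p a b = true) : ∃ f : α → β, Computable f ∧ ∀ a, p a (f a) = true := by
  let g : α → ℕ → Option β := fun a n =>
    (Encodable.decode (α := β) n).bind fun b => if p a b = true then some b else none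
  have hg : Computable₂ g := by
    refine Primrec.to_comp (Primrec.option_bind (Primrec.decode.comp Primrec.snd) ?_)
    refine Primrec.ite (Primrec.eq.comp ?_ (.const true)) (Primrec.option_some.comp Primrec.snd)
      (.const none)
    exact hp.comp ((Primrec.fst.comp Primrec.fst).pair Primrec.snd)
  have hd : ∀ a, (Nat.rfindOpt (g a)).Dom := fun a => by
    obtain ⟨b, hb⟩ := h a
    exact Nat.rfindOpt_dom.2 ⟨Encodable.encode b, b, by simp [g, hb]⟩
  refine ⟨fun a => (Nat.rfindOpt (g a)).get (hd a), ?_, fun a => ?_⟩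
  · exact (Partrec.rfindOpt hg).of_eq fun a => (Part.some_get (hd a)).symm
  · obtain ⟨n, hn⟩ := Nat.rfindOpt_spec (Part.get_mem (hd a))
    simp only [g, Option.mem_def, Option.bind_eq_some_iff] at hn
    obtain ⟨c, -, hc⟩ := hn
    split_ifs at hc with h'
    have hc' := Option.some.inj hc
    subst hc'
    exact h'

end Primrec

/-! ### The synthesis procedure

A thread follows finitely many instructions, its picks, in the order in which they were fetched. It
records core, operation and (capped) age of each pick, where the age is the number of instructions
that were fetched later on the same core, and the order in which events of the picks were scheduled.
A control state is the list of all threads of bounded size that are consistent with the past. -/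

/-- The input of the synthesis procedure. -/
abbrev Input : Type := SemCode × ℕ

/-- Core, operation and age of a picked instruction. -/
abbrev Pick : Type := ℕ × ℕ × ℕ

/-- The picks, and the scheduled events of the picks as pairs of a position and a stage. -/
abbrev Thread : Type := List Pick × List (ℕ × ℕ)

def Input.cores (x : Input) : ℕ := x.1.1.1
def Input.ops (x : Input) : ℕ := x.1.1.2.1
def Input.stages (x : Input) : ℕ := x.1.1.2.2

/-- The history parameter. -/
def Input.hist (x : Input) : ℕ := x.2 + 1

/-- The maximal number of picks of a thread. -/
def Input.width (x : Input) : ℕ := (x.1.2.2.map List.length).foldr max 0 + 1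

/-- The cap makes ages finite in number. Ages below `H` stay exact, and the model addresses no
others. -/
def Pick.bump (H c : ℕ) (p : Pick) : Pick :=
  if p.1 = c then (p.1, p.2.1, min H (p.2.2 + 1)) else p

/-- The threads that a thread may become when an instruction is fetched. -/
def Thread.fetch (K H c o : ℕ) (θ : Thread) : List Thread :=
  (θ.1.map (Pick.bump H c), θ.2) ::
    if θ.1.length < K then [(θ.1.map (Pick.bump H c) ++ [(c, o, 0)], θ.2)] else []

/-- The position of the pick of age `n` on core `c`. -/
def Thread.find (c n : ℕ) (θ : Thread) : ℕ := (θ.1.map fun p => (p.1, p.2.2)).idxOf (c, n)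

/-- If no pick has age `n` on core `c`, then `find` returns the number of picks. This is no position
in the log of a thread that occurs, so such a thread never forbids the event. -/
def Thread.fresh (c n st : ℕ) (θ : Thread) : Bool := !decide ((θ.find c n, st) ∈ θ.2)

def Thread.sched (c n st : ℕ) (θ : Thread) : Thread :=
  if θ.find c n < θ.1.length then (θ.1, θ.2 ++ [(θ.find c n, st)]) else θ

/-- Removing repetitions is what leaves only finitely many possible control states. -/
def fetchAll (K H c o : ℕ) (m : List Thread) : List Thread :=
  nub (m.flatMap fun θ => θ.fetch K H c o)

def schedAll (c n st : ℕ) (m : List Thread) : List Thread :=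
  nub (m.map fun θ => θ.sched c n st)

/-- The effect of the action with code `a` on a control state when the heads read `r`. -/
def step (x : Input) (m : List Thread) (r : List (Option ℕ)) (a : ℕ × List ℕ) :
    Option (List Thread) :=
  if a.1 = 0 then
    (r.getD (a.2.getD 0 0) none).map fun o => fetchAll x.width x.hist (a.2.getD 0 0) o m
  else if a.1 = 2 then
    if (m.all fun θ => θ.fresh (a.2.getD 0 0) (a.2.getD 1 0) (a.2.getD 2 0)) = true then
      some (schedAll (a.2.getD 0 0) (a.2.getD 1 0) (a.2.getD 2 0) m)
    else none
  -- Dropping an instruction from the history does not affect the threads.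
  else some m

/-- All words of length `n` over the list `s`. -/
def words {α : Type*} (s : List α) : ℕ → List (List α)
  | 0 => [[]]
  | n + 1 => (words s n).flatMap fun l => s.map fun a => a :: l

/-- All words of length `n` over the list `s` without repetitions. -/
def injWords {α : Type*} [DecidableEq α] (s : List α) : ℕ → List (List α)
  | 0 => [[]]
  | n + 1 => (injWords s n).flatMap fun l => s.flatMap fun a => if a ∈ l then [] else [a :: l]

/-- What the heads may read. -/
def Input.guards (x : Input) : List (List (Option ℕ)) :=
  words (none :: (List.range x.ops).map some) x.cores

/-- The codes of the actions of the model. -/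
def Input.actions (x : Input) : List (ℕ × List ℕ) :=
  (List.range x.cores).flatMap fun c =>
    -- The only drop has index `t`, the oldest entry of a full history of `t + 1` instructions.
    (0, [c]) :: (3, [c, x.2]) ::
      (List.range x.hist).flatMap fun n => (List.range x.stages).map fun st => (2, [c, n, st])

/-- The truth value of an atom, for the picks of `θ` at the positions `v`. -/
def atomVal (x : Input) (θ : Thread) (v : List ℕ) (tok : Token) : Bool :=
  if tok.1 = 0 then
    decide ((θ.1.getD (v.getD (tok.2.getD 0 0) 0) (0, 0, 0)).1 =
      (θ.1.getD (v.getD (tok.2.getD 1 0) 0) (0, 0, 0)).1) &&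
    -- Picks are listed in fetch order, so on a common core the earlier position has the smaller
    -- label.
    decide (v.getD (tok.2.getD 0 0) 0 < v.getD (tok.2.getD 1 0) 0)
  else if tok.1 = 1 then
    decide (θ.2.idxOf (v.getD (tok.2.getD 0 0) 0, tok.2.getD 1 0) <
      θ.2.idxOf (v.getD (tok.2.getD 2 0) 0, tok.2.getD 3 0))
  else
    -- The truth table is indexed by the operations of the arguments, read as digits in base
    -- `x.ops`.
    (x.1.2.1.getD (tok.2.getD 0 0) (0, [])).2.getD
      (tok.2.tail.foldr
        (fun m r => (θ.1.getD (v.getD m 0) (0, 0, 0)).2.1 + x.ops * r) 0) false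

/-- Evaluation of a formula in postfix notation; quantifiers are skipped. -/
def evalTok (x : Input) (θ : Thread) (v : List ℕ) (stk : List Bool) (tok : Token) : List Bool :=
  if tok.1 < 3 then atomVal x θ v tok :: stk
  else if tok.1 = 3 then (stk.getD 1 false && stk.getD 0 false) :: stk.tail.tail
  else if tok.1 = 4 then (stk.getD 1 false || stk.getD 0 false) :: stk.tail.tail
  else if tok.1 = 5 then (!stk.getD 0 false) :: stk.tail
  else stk

def eval (x : Input) (θ : Thread) (v : List ℕ) (ax : List Token) (stk : List Bool) : List Bool :=
  ax.foldl (fun s tok => evalTok x θ v s tok) stk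

/-- The number of universal quantifiers. -/
def arityOf (ax : List Token) : ℕ := ax.foldr (fun tok n => if tok.1 = 6 then n + 1 else n) 0

/-- All events of the picks have been scheduled. -/
def Thread.complete (D : ℕ) (θ : Thread) : Bool :=
  (List.range θ.1.length).all fun j => (List.range D).all fun st => decide ((j, st) ∈ θ.2)

/-- The picks satisfy the matrix of `ax` in every order. -/
def Thread.satisfies (x : Input) (θ : Thread) (ax : List Token) : Bool :=
  (injWords (List.range θ.1.length) (arityOf ax)).all fun v =>
    decide (eval x θ v ax [] = [true])

def accepting (x : Input) (m : List Thread) : Bool :=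
  m.all fun θ => θ.complete x.stages && x.1.2.2.all fun ax => θ.satisfies x ax

/-- The initial control state. -/
def initState : List Thread := [([], [])]

/-- `Q` contains the initial control state and is closed under the steps of the model. -/
def closedUnder (x : Input) (Q : List (List Thread)) : Bool :=
  decide (initState ∈ Q) && Q.all fun m => x.guards.all fun r => x.actions.all fun a =>
    (step x m r a).toList.all fun m' => decide (m' ∈ Q)

/-- The transitions between the control states `Q`. -/
def moves (x : Input) (Q : List (List Thread)) : List (ℕ × List (Option ℕ) × ℕ × (ℕ × List ℕ)) :=
  Q.flatMap fun m => x.guards.flatMap fun r => x.actions.flatMap fun a =>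
    (step x m r a).toList.map fun m' => (Q.idxOf m, r, Q.idxOf m', a)

/-- The guard requires every head to be at its end marker: only then do the threads cover all
instructions of the program. -/
def finalMove (x : Input) (q N : ℕ) : ℕ × List (Option ℕ) × ℕ × (ℕ × List ℕ) :=
  (q, (List.range x.cores).map fun _ => none, N, (1, []))

/-- The transitions into the final state. -/
def finalMoves (x : Input) (Q : List (List Thread)) :
    List (ℕ × List (Option ℕ) × ℕ × (ℕ × List ℕ)) :=
  Q.flatMap fun m => if accepting x m = true then [finalMove x (Q.idxOf m) Q.length] else []

/-- The code of the model with the control states `Q` and an additional final state. -/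
def modelCode (x : Input) (Q : List (List Thread)) : ModelCode :=
  ((Q.length + 1, x.hist, Q.idxOf initState, Q.length), moves x Q ++ finalMoves x Q)

/-! ### Primitive recursiveness of the synthesis procedure -/

section Primrec

variable {α β : Type*} [Primcodable α] [Primcodable β]

@[fun_prop]
theorem primrec_cores {x : α → Input} (h : Primrec x) : Primrec fun a => (x a).cores := by
  unfold Input.cores; fun_prop

@[fun_prop]
theorem primrec_ops {x : α → Input} (h : Primrec x) : Primrec fun a => (x a).ops := by
  unfold Input.ops; fun_prop

@[fun_prop]
theorem primrec_stages {x : α → Input} (h : Primrec x) : Primrec fun a => (x a).stages := by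
  unfold Input.stages; fun_prop

@[fun_prop]
theorem primrec_hist {x : α → Input} (h : Primrec x) : Primrec fun a => (x a).hist := by
  unfold Input.hist; fun_prop

@[fun_prop]
theorem primrec_width {x : α → Input} (h : Primrec x) : Primrec fun a => (x a).width := by
  unfold Input.width; fun_prop

@[fun_prop]
theorem primrec_bump {H c : α → ℕ} {p : α → Pick} (hH : Primrec H) (hc : Primrec c)
    (hp : Primrec p) : Primrec fun a => (p a).bump (H a) (c a) := by
  unfold Pick.bump; fun_prop

@[fun_prop]
theorem primrec_fetch {K H c o : α → ℕ} {θ : α → Thread} (hK : Primrec K) (hH : Primrec H)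
    (hc : Primrec c) (ho : Primrec o) (hθ : Primrec θ) :
    Primrec fun a => (θ a).fetch (K a) (H a) (c a) (o a) := by
  unfold Thread.fetch; fun_prop

@[fun_prop]
theorem primrec_find {c n : α → ℕ} {θ : α → Thread} (hc : Primrec c) (hn : Primrec n)
    (hθ : Primrec θ) : Primrec fun a => (θ a).find (c a) (n a) := by
  unfold Thread.find; fun_prop

@[fun_prop]
theorem primrec_fresh {c n st : α → ℕ} {θ : α → Thread} (hc : Primrec c) (hn : Primrec n)
    (hs : Primrec st) (hθ : Primrec θ) : Primrec fun a => (θ a).fresh (c a) (n a) (st a) := by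
  unfold Thread.fresh; fun_prop

@[fun_prop]
theorem primrec_sched {c n st : α → ℕ} {θ : α → Thread} (hc : Primrec c) (hn : Primrec n)
    (hs : Primrec st) (hθ : Primrec θ) : Primrec fun a => (θ a).sched (c a) (n a) (st a) := by
  unfold Thread.sched; fun_prop

@[fun_prop]
theorem primrec_fetchAll {K H c o : α → ℕ} {m : α → List Thread} (hK : Primrec K)
    (hH : Primrec H) (hc : Primrec c) (ho : Primrec o) (hm : Primrec m) :
    Primrec fun a => fetchAll (K a) (H a) (c a) (o a) (m a) := by
  unfold fetchAll; fun_prop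

@[fun_prop]
theorem primrec_schedAll {c n st : α → ℕ} {m : α → List Thread} (hc : Primrec c)
    (hn : Primrec n) (hs : Primrec st) (hm : Primrec m) :
    Primrec fun a => schedAll (c a) (n a) (st a) (m a) := by
  unfold schedAll; fun_prop

@[fun_prop]
theorem primrec_step {x : α → Input} {m : α → List Thread} {r : α → List (Option ℕ)}
    {k : α → ℕ × List ℕ} (hx : Primrec x) (hm : Primrec m) (hr : Primrec r) (hk : Primrec k) :
    Primrec fun a => step (x a) (m a) (r a) (k a) := by
  unfold step; fun_prop

@[fun_prop]
theorem primrec_words {s : α → List β} {n : α → ℕ} (hs : Primrec s) (hn : Primrec n) :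
    Primrec fun a => words (s a) (n a) := by
  refine (Primrec.nat_rec' (h := fun a p => p.2.flatMap fun l => (s a).map fun b => b :: l)
    hn (.const [[]]) ?_).of_eq fun a => ?_
  · change Primrec fun p : α × ℕ × List (List β) => _
    fun_prop
  · induction n a with
    | zero => rfl
    | succ k ih => simp only [words, ← ih]

@[fun_prop]
theorem primrec_injWords [DecidableEq β] {s : α → List β} {n : α → ℕ} (hs : Primrec s)
    (hn : Primrec n) : Primrec fun a => injWords (s a) (n a) := by
  refine (Primrec.nat_rec' (h := fun a p => p.2.flatMap fun l => (s a).flatMap fun b =>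
    if b ∈ l then [] else [b :: l]) hn (.const [[]]) ?_).of_eq fun a => ?_
  · change Primrec fun p : α × ℕ × List (List β) => _
    fun_prop
  · induction n a with
    | zero => rfl
    | succ k ih => simp only [injWords, ← ih]

@[fun_prop]
theorem primrec_guards {x : α → Input} (h : Primrec x) : Primrec fun a => (x a).guards := by
  unfold Input.guards; fun_prop

@[fun_prop]
theorem primrec_actions {x : α → Input} (h : Primrec x) : Primrec fun a => (x a).actions := by
  unfold Input.actions; fun_prop

@[fun_prop]
theorem primrec_atomVal {x : α → Input} {θ : α → Thread} {v : α → List ℕ} {tok : α → Token}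
    (hx : Primrec x) (hθ : Primrec θ) (hv : Primrec v) (ht : Primrec tok) :
    Primrec fun a => atomVal (x a) (θ a) (v a) (tok a) := by
  unfold atomVal; fun_prop

@[fun_prop]
theorem primrec_evalTok {x : α → Input} {θ : α → Thread} {v : α → List ℕ} {stk : α → List Bool}
    {tok : α → Token} (hx : Primrec x) (hθ : Primrec θ) (hv : Primrec v) (hs : Primrec stk)
    (ht : Primrec tok) : Primrec fun a => evalTok (x a) (θ a) (v a) (stk a) (tok a) := by
  unfold evalTok; fun_prop

@[fun_prop]
theorem primrec_eval {x : α → Input} {θ : α → Thread} {v : α → List ℕ} {ax : α → List Token}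
    {stk : α → List Bool} (hx : Primrec x) (hθ : Primrec θ) (hv : Primrec v) (ha : Primrec ax)
    (hs : Primrec stk) : Primrec fun a => eval (x a) (θ a) (v a) (ax a) (stk a) := by
  unfold eval; fun_prop

@[fun_prop]
theorem primrec_arityOf {ax : α → List Token} (h : Primrec ax) :
    Primrec fun a => arityOf (ax a) := by
  unfold arityOf; fun_prop

@[fun_prop]
theorem primrec_complete {D : α → ℕ} {θ : α → Thread} (hD : Primrec D) (hθ : Primrec θ) :
    Primrec fun a => (θ a).complete (D a) := by
  unfold Thread.complete; fun_prop

@[fun_prop]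
theorem primrec_satisfies {x : α → Input} {θ : α → Thread} {ax : α → List Token}
    (hx : Primrec x) (hθ : Primrec θ) (ha : Primrec ax) :
    Primrec fun a => (θ a).satisfies (x a) (ax a) := by
  unfold Thread.satisfies; fun_prop

@[fun_prop]
theorem primrec_accepting {x : α → Input} {m : α → List Thread} (hx : Primrec x)
    (hm : Primrec m) : Primrec fun a => accepting (x a) (m a) := by
  unfold accepting; fun_prop

theorem primrec_closedUnder : Primrec fun p : Input × List (List Thread) =>
    closedUnder p.1 p.2 := by
  unfold closedUnder; fun_prop

theorem primrec_moves : Primrec fun p : Input × List (List Thread) => moves p.1 p.2 := by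
  unfold moves; fun_prop

@[fun_prop]
theorem primrec_finalMove {x : α → Input} {q N : α → ℕ} (hx : Primrec x) (hq : Primrec q)
    (hN : Primrec N) : Primrec fun a => finalMove (x a) (q a) (N a) := by
  unfold finalMove; fun_prop

theorem primrec_finalMoves : Primrec fun p : Input × List (List Thread) =>
    finalMoves p.1 p.2 := by
  refine Primrec.list_flatMap Primrec.snd (Primrec.ite (Primrec.eq.comp ?_ (.const true)) ?_ ?_)
  all_goals fun_prop

theorem primrec_modelCode : Primrec fun p : Input × List (List Thread) =>
    modelCode p.1 p.2 := by
  have h₁ := primrec_moves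
  have h₂ := primrec_finalMoves
  unfold modelCode; fun_prop

end Primrec

/-! ### Finiteness of the set of control states -/

theorem mem_words {α : Type*} {s l : List α} {n : ℕ} :
    l ∈ words s n ↔ l.length = n ∧ ∀ a ∈ l, a ∈ s := by
  induction n generalizing l with
  | zero => simp only [words, List.mem_singleton]; cases l <;> simp
  | succ n ih =>
    simp only [words, List.mem_flatMap, List.mem_map, ih]
    constructor
    · rintro ⟨l', ⟨h, h'⟩, a, ha, rfl⟩
      simp only [List.length_cons, h, List.forall_mem_cons]
      exact ⟨trivial, ha, h'⟩
    · rintro ⟨h, h'⟩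
      cases l with
      | nil => simp at h
      | cons a l =>
        rw [List.forall_mem_cons] at h'
        exact ⟨l, ⟨by simpa using h, h'.2⟩, a, h'.1, rfl⟩

theorem mem_injWords {α : Type*} [DecidableEq α] {s l : List α} {n : ℕ} :
    l ∈ injWords s n ↔ l.length = n ∧ l.Nodup ∧ ∀ a ∈ l, a ∈ s := by
  induction n generalizing l with
  | zero => simp only [injWords, List.mem_singleton]; cases l <;> simp
  | succ n ih =>
    simp only [injWords, List.mem_flatMap, ih]
    constructor
    · rintro ⟨l', ⟨h, h', h''⟩, a, ha, hl⟩
      split_ifs at hl with hal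
      · simp at hl
      · rw [List.mem_singleton] at hl
        subst hl
        simp only [List.length_cons, h, List.forall_mem_cons, List.nodup_cons]
        exact ⟨trivial, ⟨hal, h'⟩, ha, h''⟩
    · rintro ⟨h, h', h''⟩
      cases l with
      | nil => simp at h
      | cons a l =>
        rw [List.forall_mem_cons] at h''
        rw [List.nodup_cons] at h'
        exact ⟨l, ⟨by simpa using h, h'.2, h''.2⟩, a, h''.1, by simp [h'.1]⟩

theorem finite_setOf_nodup {α : Type*} {s : Set α} (hs : s.Finite) :
    {l : List α | l.Nodup ∧ ∀ a ∈ l, a ∈ s}.Finite := by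
  classical
  have := hs.fintype
  refine (Set.finite_range fun l : {l : List s // l.Nodup} => l.1.map Subtype.val).subset ?_
  rintro l ⟨h, h'⟩
  refine ⟨⟨l.attachWith _ h', ?_⟩, by simp⟩
  exact List.Nodup.of_map Subtype.val (by simpa using h)

theorem finite_setOf_length_le {α : Type*} {s : Set α} (hs : s.Finite) (n : ℕ) :
    {l : List α | l.length ≤ n ∧ ∀ a ∈ l, a ∈ s}.Finite := by
  have := hs.to_subtype
  refine ((List.finite_length_le s n).image (List.map Subtype.val)).subset ?_
  rintro l ⟨h, h'⟩
  exact ⟨l.attachWith _ h', by simpa using h, by simp⟩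

/-- The threads that can occur in the model. -/
structure Thread.Bounded (x : Input) (θ : Thread) : Prop where
  length_le : θ.1.length ≤ x.width
  picks : ∀ p ∈ θ.1, p.1 < x.cores ∧ p.2.1 < x.ops ∧ p.2.2 ≤ x.hist
  nodup : θ.2.Nodup
  log : ∀ e ∈ θ.2, e.1 < x.width ∧ e.2 < x.stages

/-- The width bounds the number of picks, the cap bounds their ages, and a log without repetitions
over finitely many pairs has bounded length. -/
theorem finite_bounded (x : Input) : {θ : Thread | θ.Bounded x}.Finite := by
  have h₁ : {p : Pick | p.1 < x.cores ∧ p.2.1 < x.ops ∧ p.2.2 ≤ x.hist}.Finite :=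
    ((Set.finite_lt_nat x.cores).prod
      ((Set.finite_lt_nat x.ops).prod (Set.finite_le_nat x.hist))).subset fun p hp => hp
  have h₂ : {e : ℕ × ℕ | e.1 < x.width ∧ e.2 < x.stages}.Finite :=
    ((Set.finite_lt_nat x.width).prod (Set.finite_lt_nat x.stages)).subset fun p hp => hp
  exact ((finite_setOf_length_le h₁ x.width).prod (finite_setOf_nodup h₂)).subset fun θ h =>
    ⟨⟨h.length_le, h.picks⟩, h.nodup, h.log⟩

theorem Thread.Bounded.of_mem_fetch {x : Input} {c o : ℕ} (hc : c < x.cores) (ho : o < x.ops)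
    {θ θ' : Thread} (h : θ.Bounded x) (h' : θ' ∈ θ.fetch x.width x.hist c o) :
    θ'.Bounded x := by
  have hp : ∀ p ∈ θ.1.map (Pick.bump x.hist c),
      p.1 < x.cores ∧ p.2.1 < x.ops ∧ p.2.2 ≤ x.hist := by
    intro p hp
    obtain ⟨q, hq, rfl⟩ := List.mem_map.1 hp
    have := h.picks q hq
    unfold Pick.bump
    split_ifs
    · exact ⟨this.1, this.2.1, min_le_left _ _⟩
    · exact this
  unfold Thread.fetch at h'
  rw [List.mem_cons] at h'
  rcases h' with rfl | h'
  · exact ⟨by simpa using h.length_le, hp, h.nodup, h.log⟩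
  · split_ifs at h' with hK
    · rw [List.mem_singleton] at h'
      subst h'
      refine ⟨by simpa using hK, fun p hp' => ?_, h.nodup, h.log⟩
      rcases List.mem_append.1 hp' with hp' | hp'
      · exact hp p hp'
      · rw [List.mem_singleton] at hp'
        subst hp'
        exact ⟨hc, ho, Nat.zero_le _⟩
    · simp at h'

/-- The freshness test keeps the log free of repetitions; without it logs could grow forever. -/
theorem Thread.Bounded.sched {x : Input} {c n st : ℕ} (hs : st < x.stages) {θ : Thread}
    (h : θ.Bounded x) (hf : θ.fresh c n st = true) : (θ.sched c n st).Bounded x := by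
  unfold Thread.sched
  split_ifs with hlt
  · have hf' : (θ.find c n, st) ∉ θ.2 := by simpa [Thread.fresh] using hf
    refine ⟨h.length_le, h.picks, List.nodup_append.2 ⟨h.nodup, by simp, ?_⟩, fun e he => ?_⟩
    · rintro a ha b hb rfl
      exact hf' (List.mem_singleton.1 hb ▸ ha)
    · rcases List.mem_append.1 he with he | he
      · exact h.log e he
      · rw [List.mem_singleton] at he
        subst he
        exact ⟨hlt.trans_le h.length_le, hs⟩
  · exact h

/-! ### A closed list of control states, and the search for it -/

theorem mem_guards {x : Input} {r : List (Option ℕ)} :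
    r ∈ x.guards ↔ r.length = x.cores ∧ ∀ o, some o ∈ r → o < x.ops := by
  unfold Input.guards
  rw [mem_words]
  refine and_congr_right fun _ => ⟨fun h o ho => by simpa using h _ ho, fun h a ha => ?_⟩
  cases a with
  | none => simp
  | some o => simpa using h o ha

theorem mem_actions {x : Input} {a : ℕ × List ℕ} :
    a ∈ x.actions ↔ ∃ c < x.cores, a = (0, [c]) ∨ a = (3, [c, x.2]) ∨
      ∃ n < x.hist, ∃ st < x.stages, a = (2, [c, n, st]) := by
  simp only [Input.actions, List.mem_flatMap, List.mem_range, List.mem_cons, List.mem_map,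
    eq_comm (a := a)]

theorem closedUnder_iff {x : Input} {Q : List (List Thread)} :
    closedUnder x Q = true ↔ initState ∈ Q ∧
      ∀ m ∈ Q, ∀ r ∈ x.guards, ∀ a ∈ x.actions, ∀ m', step x m r a = some m' → m' ∈ Q := by
  simp [closedUnder]

/-- All repetition-free lists of bounded threads form a finite closed set. It serves only to show
that the search terminates. -/
theorem exists_closedUnder (x : Input) : ∃ Q, closedUnder x Q = true := by
  obtain ⟨Q, hQ⟩ := (finite_setOf_nodup (finite_bounded x)).exists_finset
  refine ⟨Q.toList, closedUnder_iff.2 ⟨?_, ?_⟩⟩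
  · rw [Finset.mem_toList, hQ]
    refine ⟨List.nodup_singleton _, ?_⟩
    simp only [initState, List.mem_singleton, forall_eq]
    exact ⟨Nat.zero_le _, by simp, List.nodup_nil, by simp⟩
  · intro m hm r hr a ha m' hm'
    rw [Finset.mem_toList, hQ] at hm ⊢
    obtain ⟨c, hc, rfl | rfl | ⟨n, -, st, hst, rfl⟩⟩ := mem_actions.1 ha
    · simp only [step, if_true, Option.map_eq_some_iff, List.getD_cons_zero] at hm'
      obtain ⟨o, ho, rfl⟩ := hm'
      have ho' : o < x.ops := by
        refine (mem_guards.1 hr).2 o ?_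
        rw [List.getD_eq_getElem?_getD, Option.getD_eq_iff] at ho
        rcases ho with ho | ho
        · exact List.mem_of_getElem? ho
        · simp at ho
      refine ⟨nodup_nub _, fun θ hθ => ?_⟩
      rw [fetchAll, mem_nub, List.mem_flatMap] at hθ
      obtain ⟨θ', hθ', h⟩ := hθ
      exact Thread.Bounded.of_mem_fetch hc ho' (hm.2 θ' hθ') h
    · simp only [step] at hm'
      cases hm'
      exact hm
    · simp only [step] at hm'
      norm_num at hm'
      obtain ⟨hf, rfl⟩ := hm'
      refine ⟨nodup_nub _, fun θ hθ => ?_⟩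
      rw [schedAll, mem_nub, List.mem_map] at hθ
      obtain ⟨θ', hθ', rfl⟩ := hθ
      exact Thread.Bounded.sched hst (hm.2 θ' hθ') (hf _ _ hθ')

theorem exists_computable_modelCode : ∃ synth : Input → ModelCode, Computable synth ∧
    ∀ x, ∃ Q, closedUnder x Q = true ∧ synth x = modelCode x Q := by
  obtain ⟨f, hf, hf'⟩ := exists_computable_choice primrec_closedUnder exists_closedUnder
  have h : Computable fun p : Input × List (List Thread) => modelCode p.1 p.2 :=
    primrec_modelCode.to_comp
  have h' : Computable fun x : Input => (x, f x) := Computable.id.pair hf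
  have h'' := h.comp h'
  exact ⟨fun x => modelCode x (f x), h'', fun x => ⟨f x, hf' x, rfl⟩⟩

theorem mem_modelCode {x : Input} {Q : List (List Thread)} {q q' : ℕ} {r : List (Option ℕ)}
    {a : ℕ × List ℕ} : (q, r, q', a) ∈ (modelCode x Q).2 ↔
      (∃ m ∈ Q, r ∈ x.guards ∧ a ∈ x.actions ∧ ∃ m', step x m r a = some m' ∧
        q = Q.idxOf m ∧ q' = Q.idxOf m') ∨
      ∃ m ∈ Q, accepting x m = true ∧ q = Q.idxOf m ∧ r = List.replicate x.cores none ∧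
        q' = Q.length ∧ a = (1, []) := by
  rw [modelCode, List.mem_append]
  refine or_congr ?_ ?_
  · simp only [moves, List.mem_flatMap, List.mem_map, Option.mem_toList,
      Prod.mk.injEq]
    constructor
    · rintro ⟨m, hm, r, hr, a, ha, m', h, rfl, rfl, rfl, rfl⟩
      exact ⟨m, hm, hr, ha, m', h, rfl, rfl⟩
    · rintro ⟨m, hm, hr, ha, m', h, rfl, rfl⟩
      exact ⟨m, hm, r, hr, a, ha, m', h, rfl, rfl, rfl, rfl⟩
  · simp only [finalMoves, List.mem_flatMap]
    refine exists_congr fun m => and_congr_right fun _ => ?_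
    split_ifs with h
    · simp [h, finalMove]
    · simp [h]

/-! ### Traces as linear graphs -/

variable {S : Sig}

instance : DecidableEq (Instr S) := fun a b =>
  decidable_of_iff (a.core = b.core ∧ a.label = b.label ∧ a.op = b.op) (by
    cases a; cases b; simp)

instance : DecidableEq (Event S) := fun a b =>
  decidable_of_iff (a.instr = b.instr ∧ a.stage = b.stage) (by cases a; cases b; simp)

/-- The graph of the program `P` whose edges are given by the order of the trace `τ`. -/
def traceGraph (P : Program S) (τ : List (Event S)) : EventGraph S where
  V := P.events
  E := Precedes τ

/-- In a repetition-free trace the position of an event is its `idxOf`. An absent `a` has the length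
of the trace as index, which is not below that of `b`, so only membership of `b` is needed. -/
theorem precedes_iff_idxOf {τ : List (Event S)} (hτ : τ.Nodup) {a b : Event S} (hb : b ∈ τ) :
    Precedes τ a b ↔ τ.idxOf a < τ.idxOf b := by
  constructor
  · rintro ⟨i, j, hij, hi, hj⟩
    obtain ⟨hi', rfl⟩ := List.getElem?_eq_some_iff.1 hi
    obtain ⟨hj', rfl⟩ := List.getElem?_eq_some_iff.1 hj
    rwa [hτ.idxOf_getElem, hτ.idxOf_getElem]
  · intro h
    have hb' := List.idxOf_lt_length_iff.2 hb
    exact ⟨τ.idxOf a, τ.idxOf b, h, List.getElem?_idxOf (List.idxOf_lt_length_iff.1 (h.trans hb')),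
      List.getElem?_idxOf hb⟩

theorem Precedes.mem {τ : List (Event S)} {a b : Event S} (h : Precedes τ a b) :
    a ∈ τ ∧ b ∈ τ := by
  obtain ⟨i, j, -, hi, hj⟩ := h
  exact ⟨List.mem_of_getElem? hi, List.mem_of_getElem? hj⟩

theorem Precedes.trans {τ : List (Event S)} (hτ : τ.Nodup) {a b c : Event S}
    (h : Precedes τ a b) (h' : Precedes τ b c) : Precedes τ a c := by
  have hc := h'.mem.2
  rw [precedes_iff_idxOf hτ h.mem.2] at h
  rw [precedes_iff_idxOf hτ hc] at h' ⊢
  exact h.trans h'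

theorem traceGraph_hb {P : Program S} {τ : List (Event S)} (hτ : τ.Nodup) {a b : Event S} :
    (traceGraph P τ).Hb a b ↔ Precedes τ a b := by
  constructor
  · intro h
    induction h with
    | single h => exact h
    | tail _ h ih => exact ih.trans hτ h
  · exact Relation.TransGen.single

theorem traceGraph_isHbGraph {P : Program S} {τ : List (Event S)} (hτ : τ.Nodup)
    (h : ∀ e, e ∈ τ ↔ e ∈ P.events) : (traceGraph P τ).IsHbGraph P where
  nodes := rfl
  edges a b hab := ⟨(h a).1 (Precedes.mem hab).1, (h b).1 (Precedes.mem hab).2⟩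
  acyclic a ha := by
    rw [traceGraph_hb hτ] at ha
    exact lt_irrefl _ ((precedes_iff_idxOf hτ ha.mem.2).1 ha)

theorem isLinearization_traceGraph {P : Program S} {τ : List (Event S)} (hτ : τ.Nodup)
    (h : ∀ e, e ∈ τ ↔ e ∈ P.events) : IsLinearization τ (traceGraph P τ) :=
  ⟨hτ, h, fun _ _ => (traceGraph_hb hτ).1⟩

/-- The linear graph of a linearization of a valid graph is valid. -/
theorem Semantics.Refinable.valid_traceGraph {A : Semantics S} (hA : A.Refinable) {P : Program S}
    {G : EventGraph S} (hG : A.Valid P G) {τ : List (Event S)} (hτ : IsLinearization τ G) :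
    A.Valid P (traceGraph P τ) := by
  have hmem : ∀ e, e ∈ τ ↔ e ∈ P.events := fun e => by rw [hτ.2.1, hG.1.nodes]
  refine hA P G hG _ (traceGraph_isHbGraph hτ.1 hmem) ?_
    ⟨hG.1.nodes, fun a b hab => (traceGraph_hb hτ.1).2 (hτ.2.2 a b hab)⟩
  intro a ha b hb hab
  have ha' := (hmem a).2 ha
  have hb' := (hmem b).2 hb
  rw [traceGraph_hb hτ.1, traceGraph_hb hτ.1, precedes_iff_idxOf hτ.1 hb',
    precedes_iff_idxOf hτ.1 ha']
  exact lt_or_gt_of_ne fun h => hab ((List.idxOf_inj ha').1 h)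

/-! ### Threads of a trace -/

/-- The part of the list `τ` of scheduled events that concerns the instructions in `ω`. -/
def eventLog (τ : List (Event S)) (ω : List (Instr S)) : List (ℕ × ℕ) :=
  τ.filterMap fun e => if e.instr ∈ ω then some (ω.idxOf e.instr, e.stage.val) else none

/-- The number of instructions in `F` on core `c`. -/
def fetched (F : List (Instr S)) (c : S.Core) : ℕ := F.countP (·.core = c)

/-- The thread that picks `ω` when the instructions in `F` have been fetched and the events in `τ`
have been scheduled. -/
def threadOf (H : ℕ) (F : List (Instr S)) (τ : List (Event S)) (ω : List (Instr S)) : Thread :=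
  (ω.map fun i => (i.core.val, i.op.val, min H (fetched F i.core - 1 - i.label)), eventLog τ ω)

theorem idxOf_cons_lt_iff {α : Type*} [BEq α] [LawfulBEq α] {e a b : α} {l : List α} :
    (e :: l).idxOf a < (e :: l).idxOf b ↔ e ≠ b ∧ (e = a ∨ l.idxOf a < l.idxOf b) := by
  by_cases hb : e = b
  · subst hb
    simp
  · rw [List.idxOf_cons_ne _ hb]
    by_cases ha : e = a
    · subst ha
      simp [hb]
    · rw [List.idxOf_cons_ne _ ha]
      simp [ha, hb]

/-- `f` produces `a'` only from `a` and `b'` only from `b`, so filtering keeps their order. Absent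
elements get the length of the list as index on both sides, hence no membership assumption. -/
theorem idxOf_filterMap_lt_iff {α β : Type*} [BEq α] [LawfulBEq α] [BEq β] [LawfulBEq β]
    {f : α → Option β} {a b : α} {a' b' : β} (ha : ∀ e, f e = some a' ↔ e = a) (hb : ∀ e, f e = some b' ↔ e = b)
    (l : List α) :
    (l.filterMap f).idxOf a' < (l.filterMap f).idxOf b' ↔ l.idxOf a < l.idxOf b := by
  induction l with
  | nil => simp
  | cons e l ih =>
    cases h : f e with
    | none =>
      have hea : e ≠ a := fun he => by simpa [h] using (ha e).2 he
      have heb : e ≠ b := fun he => by simpa [h] using (hb e).2 he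
      rw [List.filterMap_cons_none h, List.idxOf_cons_ne _ hea, List.idxOf_cons_ne _ heb, ih]
      omega
    | some y =>
      rw [List.filterMap_cons_some h]
      have hea : y = a' ↔ e = a := by rw [← ha, h, Option.some_inj]
      have heb : y = b' ↔ e = b := by rw [← hb, h, Option.some_inj]
      rw [idxOf_cons_lt_iff, idxOf_cons_lt_iff, ne_eq, hea, heb, ih]

theorem mem_eventLog {τ : List (Event S)} {ω : List (Instr S)} {i : Instr S} (hi : i ∈ ω)
    {st : S.Stage} : (ω.idxOf i, st.val) ∈ eventLog τ ω ↔ ⟨i, st⟩ ∈ τ := by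
  simp only [eventLog, List.mem_filterMap, Option.ite_none_right_eq_some, Option.some.injEq,
    Prod.mk.injEq]
  constructor
  · rintro ⟨⟨i', st'⟩, he, hi', h, h'⟩
    obtain rfl := (List.idxOf_inj hi').1 h
    obtain rfl := Fin.ext h'
    exact he
  · exact fun h => ⟨_, h, hi, rfl, rfl⟩

/-- This lets `hb` atoms be evaluated on the log of a thread instead of the whole trace. -/
theorem eventLog_idxOf_lt_iff {τ : List (Event S)} {ω : List (Instr S)} {i j : Instr S}
    (hi : i ∈ ω) (hj : j ∈ ω) {st st' : S.Stage} :
    (eventLog τ ω).idxOf (ω.idxOf i, st.val) < (eventLog τ ω).idxOf (ω.idxOf j, st'.val) ↔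
      τ.idxOf ⟨i, st⟩ < τ.idxOf ⟨j, st'⟩ := by
  have key : ∀ (i : Instr S) (_ : i ∈ ω) (st : S.Stage) (e : Event S),
      (if e.instr ∈ ω then some (ω.idxOf e.instr, e.stage.val) else none) =
        some (ω.idxOf i, st.val) ↔ e = ⟨i, st⟩ := by
    rintro i hi st ⟨i', st'⟩
    simp only [Option.ite_none_right_eq_some, Option.some.injEq, Prod.mk.injEq, Event.mk.injEq]
    constructor
    · rintro ⟨hi', h, h'⟩
      exact ⟨(List.idxOf_inj hi').1 h, Fin.ext h'⟩
    · rintro ⟨rfl, rfl⟩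
      exact ⟨hi, rfl, rfl⟩
  exact idxOf_filterMap_lt_iff (key i hi st) (key j hj st') τ

/-! ### Evaluation of axioms on threads -/

/-- Instructions on the same core are listed in the reference order. -/
def Ordered (F : List (Instr S)) : Prop :=
  F.Pairwise fun a b => a.core = b.core → a.label < b.label

theorem Ordered.nodup {F : List (Instr S)} (h : Ordered F) : F.Nodup :=
  List.Pairwise.imp (S := (· ≠ ·)) (fun hab heq => (hab (heq ▸ rfl)).ne (heq ▸ rfl)) h

theorem Ordered.refLT_iff {F : List (Instr S)} (h : Ordered F) {i j : Instr S} (hi : i ∈ F)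
    (hj : j ∈ F) : i.RefLT j ↔ i.core = j.core ∧ F.idxOf i < F.idxOf j := by
  have key : ∀ {i j : Instr S}, i ∈ F → j ∈ F → F.idxOf i < F.idxOf j → i.core = j.core →
      i.label < j.label := by
    intro i j hi hj hij
    have := List.pairwise_iff_getElem.1 h _ _ (List.idxOf_lt_length_iff.2 hi)
      (List.idxOf_lt_length_iff.2 hj) hij
    simpa only [List.getElem_idxOf] using this
  refine and_congr_right fun hc => ⟨fun hl => ?_, fun hl => key hi hj hl hc⟩
  rcases lt_trichotomy (F.idxOf i) (F.idxOf j) with h' | h' | h'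
  · exact h'
  · rw [(List.idxOf_inj hi).1 h'] at hl
    exact absurd hl (lt_irrefl _)
  · exact absurd hl (key hj hi h' hc.symm).asymm

/-- Horner's scheme: the fold computes the numeral by which `finFunctionFinEquiv` indexes truth
tables. -/
theorem foldr_ofFn {n : ℕ} (b : ℕ) (f : ℕ → ℕ) (g : Fin n → ℕ) :
    (List.ofFn g).foldr (fun m r => f m + b * r) 0 = ∑ i, f (g i) * b ^ (i : ℕ) := by
  induction n with
  | zero => simp
  | succ n ih =>
    rw [List.ofFn_succ, List.foldr_cons, ih, Fin.sum_univ_succ, Finset.mul_sum]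
    simp only [Fin.val_zero, pow_zero, mul_one, Fin.val_succ, pow_succ]
    congr 1
    exact Finset.sum_congr rfl fun i _ => by ring

theorem getD_ofFn {α : Type*} {n : ℕ} (f : Fin n → α) (d : α) (i : Fin n) :
    (List.ofFn f).getD i d = f i := by
  simp [List.getD_eq_getElem?_getD]

theorem threadOf_getD {H : ℕ} {F : List (Instr S)} {τ : List (Event S)} {ω : List (Instr S)}
    {i : Instr S} (hi : i ∈ ω) (d : Pick) : (threadOf H F τ ω).1.getD (ω.idxOf i) d =
      (i.core.val, i.op.val, min H (fetched F i.core - 1 - i.label)) := by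
  simp [threadOf, List.getD_eq_getElem?_getD, List.getElem?_idxOf hi]

section Eval

variable {A : Semantics S} {t H : ℕ} {F : List (Instr S)} {τ : List (Event S)}
  {ω : List (Instr S)} {P : Program S}

theorem eval_append {x : Input} {θ : Thread} {v : List ℕ} {a b : List Token} {stk : List Bool} :
    eval x θ v (a ++ b) stk = eval x θ v b (eval x θ v a stk) :=
  List.foldl_append

theorem eval_atom {x : Input} {θ : Thread} {v : List ℕ} {tok : Token} (h : tok.1 < 3)
    {stk : List Bool} : eval x θ v [tok] stk = atomVal x θ v tok :: stk := by
  simp [eval, evalTok, h]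

-- The code of a subformula pushes its truth value and leaves the rest of the stack alone, whence
-- the induction with an arbitrary stack. As all events of the picks have been scheduled, log order
-- decides happens-before.
open Classical in
theorem eval_code (hτ : τ.Nodup) (hω : Ordered ω)
    (hev : ∀ i ∈ ω, ∀ st, (⟨i, st⟩ : Event S) ∈ τ) {k : ℕ} {s : Fin k → Instr S} {v : List ℕ}
    (hs : ∀ m, s m ∈ ω) (hv : ∀ m : Fin k, v.getD m 0 = ω.idxOf (s m)) (φ : QF S k)
    (stk : List Bool) : eval (A.code, t) (threadOf H F τ ω) v φ.code stk =
      decide (φ.Sat A (traceGraph P τ) s) :: stk := by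
  induction φ generalizing stk with
  | ref i j =>
    rw [QF.code, eval_atom (by norm_num)]
    congr 1
    simp only [atomVal, if_true, List.getD_cons_zero, List.getD_cons_succ, hv,
      threadOf_getD (hs _), QF.Sat, hω.refLT_iff (hs i) (hs j), Fin.ext_iff]
    simp
  | hb i st j st' =>
    rw [QF.code, eval_atom (by norm_num)]
    congr 1
    simp only [atomVal, List.getD_cons_zero, List.getD_cons_succ, hv, QF.Sat, threadOf,
      traceGraph_hb hτ, precedes_iff_idxOf hτ (hev _ (hs j) st'),
      eventLog_idxOf_lt_iff (hs i) (hs j)]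
    simp
  | pred p args =>
    rw [QF.code, eval_atom (by norm_num)]
    congr 1
    have hx : ((A.code, t) : Input).1.2.1.getD p.val (0, []) = (S.arity p,
        List.ofFn fun x : Fin (S.numOps ^ S.arity p) =>
          decide (finFunctionFinEquiv.symm x ∈ A.interp p)) :=
      getD_ofFn (fun p : S.Pred => (S.arity p, List.ofFn fun x : Fin (S.numOps ^ S.arity p) =>
          decide (finFunctionFinEquiv.symm x ∈ A.interp p))) (0, []) p
    have hidx : (List.ofFn fun m => (args m).val).foldr (fun m r =>
        ((threadOf H F τ ω).1.getD (v.getD m 0) (0, 0, 0)).2.1 + S.numOps * r) 0 =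
        (finFunctionFinEquiv fun m => (s (args m)).op).val := by
      rw [foldr_ofFn S.numOps fun m => ((threadOf H F τ ω).1.getD (v.getD m 0) (0, 0, 0)).2.1,
        finFunctionFinEquiv_apply]
      refine Finset.sum_congr rfl fun m _ => ?_
      rw [hv, threadOf_getD (hs _)]
    have : atomVal (A.code, t) (threadOf H F τ ω) v
        (2, p.val :: List.ofFn fun m => (args m).val) =
        ((((A.code, t) : Input).1.2.1.getD p.val (0, [])).2.getD
          ((List.ofFn fun m => (args m).val).foldr (fun m r =>
            ((threadOf H F τ ω).1.getD (v.getD m 0) (0, 0, 0)).2.1 + S.numOps * r) 0) false) := rfl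
    rw [this, hx, hidx]
    simp only [getD_ofFn, QF.Sat, Equiv.symm_apply_apply]
    congr
  | and φ ψ h₁ h₂ =>
    rw [QF.code, eval_append, eval_append, h₁, h₂]
    change (decide _ && decide _) :: stk = _
    congr 1
    rw [Bool.eq_iff_iff, Bool.and_eq_true, decide_eq_true_iff, decide_eq_true_iff, decide_eq_true_iff]
    rfl
  | or φ ψ h₁ h₂ =>
    rw [QF.code, eval_append, eval_append, h₁, h₂]
    change (decide _ || decide _) :: stk = _
    congr 1
    rw [Bool.eq_iff_iff, Bool.or_eq_true, decide_eq_true_iff, decide_eq_true_iff, decide_eq_true_iff]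
    rfl
  | not φ h =>
    rw [QF.code, eval_append, h]
    change (!decide _) :: stk = _
    congr 1
    rw [Bool.eq_iff_iff, Bool.not_eq_true', decide_eq_false_iff_not, decide_eq_true_iff]
    rfl

end Eval

/-! ### Universal axioms -/

theorem arityOf_append (a b : List Token) : arityOf (a ++ b) = arityOf a + arityOf b := by
  induction a with
  | nil => simp [arityOf]
  | cons tok a ih =>
    simp only [arityOf, List.cons_append, List.foldr_cons] at ih ⊢
    split_ifs <;> omega

theorem QF.arityOf_code {k : ℕ} (φ : QF S k) : arityOf φ.code = 0 := by
  induction φ with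
  | and φ ψ h₁ h₂ => rw [QF.code, arityOf_append, arityOf_append, h₁, h₂]; rfl
  | or φ ψ h₁ h₂ => rw [QF.code, arityOf_append, arityOf_append, h₁, h₂]; rfl
  | not φ h => rw [QF.code, arityOf_append, h]; rfl
  | _ => rfl

/-- A universal axiom says that its matrix holds for all tuples of distinct instructions. -/
theorem Ax.IsUniversal.exists_matrix {k : ℕ} {ψ : Ax S k} (h : ψ.IsUniversal) :
    ∃ (n : ℕ) (hn : k ≤ n) (φ : QF S n), ψ.code = List.replicate (n - k) (6, []) ++ φ.code ∧
      ∀ (A : Semantics S) (P : Program S) (G : EventGraph S) (s : Fin k → Instr S),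
        ψ.Sat A P G s ↔ ∀ s' : Fin n → Instr S, (∀ m, s' (Fin.castLE hn m) = s m) →
          (∀ m : Fin n, k ≤ m → s' m ∈ P.instrs ∧ ∀ m' < m, s' m' ≠ s' m) → φ.Sat A G s' := by
  induction ψ with
  | @qf k φ =>
    refine ⟨k, le_rfl, φ, by simp [Ax.code], fun A P G s => ⟨fun h s' hs' _ => ?_, fun h => ?_⟩⟩
    · rwa [show s' = s from funext hs']
    · exact h s (fun _ => rfl) fun m hm => absurd m.2 hm.not_gt
  | @all k ψ ih =>
    obtain ⟨n, hn, φ, hc, hφ⟩ := ih h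
    refine ⟨n, by omega, φ, ?_, fun A P G s => ?_⟩
    · rw [Ax.code, hc, show n - k = n - (k + 1) + 1 by omega, List.replicate_succ,
        List.cons_append]
    · simp only [Ax.Sat, hφ]
      constructor
      · intro H s' hs' hd
        have hk := hd ⟨k, hn⟩ le_rfl
        refine H (s' ⟨k, hn⟩) hk.1 ?_ s' (fun m => ?_) fun m hm => hd m (by omega)
        · rintro ⟨m, hm⟩
          refine hk.2 (Fin.castLE (by omega) m) m.2 ?_
          rw [← hm, hs']
        · refine Fin.lastCases ?_ (fun m => ?_) m
          · rw [Fin.snoc_last]; rfl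
          · rw [Fin.snoc_castSucc, ← hs']; rfl
      · intro H i hi hi' s' hs' hd
        have hlast : s' ⟨k, hn⟩ = i := by
          have := hs' (Fin.last k)
          rwa [Fin.snoc_last] at this
        have hinit : ∀ m : Fin k, s' (Fin.castLE (by omega) m) = s m := fun m => by
          have := hs' m.castSucc
          rwa [Fin.snoc_castSucc] at this
        refine H s' hinit fun m hm => ?_
        rcases hm.eq_or_lt with hm | hm
        · obtain rfl : m = ⟨k, hn⟩ := Fin.ext hm.symm
          rw [hlast]
          refine ⟨hi, fun m' hm' heq => hi' ⟨⟨m', hm'⟩, ?_⟩⟩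
          rw [← heq, ← hinit]; rfl
        · exact hd m hm
  | ex ψ => exact h.elim

/-- That each new variable avoids the earlier values amounts to injectivity of the whole tuple. -/
theorem Ax.IsUniversal.exists_matrix_sentence {ax : Ax S 0} (h : ax.IsUniversal) :
    ∃ (n : ℕ) (φ : QF S n), ax.code = List.replicate n (6, []) ++ φ.code ∧
      ∀ (A : Semantics S) (P : Program S) (G : EventGraph S),
        A.Models P G ax ↔ ∀ s : Fin n → Instr S, Function.Injective s →
          (∀ m, s m ∈ P.instrs) → φ.Sat A G s := by
  obtain ⟨n, hn, φ, hc, hφ⟩ := h.exists_matrix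
  refine ⟨n, φ, by simpa using hc, fun A P G => ?_⟩
  rw [Semantics.Models, hφ]
  constructor
  · intro H s hs hP
    exact H s (fun m => m.elim0) fun m _ => ⟨hP m, fun m' hm' heq => hm'.ne (hs heq)⟩
  · intro H s _ hs
    refine H s (fun a b hab => ?_) fun m => (hs m (Nat.zero_le _)).1
    rcases lt_trichotomy a b with h | h | h
    · exact absurd hab ((hs b (Nat.zero_le _)).2 a h)
    · exact h
    · exact absurd hab.symm ((hs a (Nat.zero_le _)).2 b h)

theorem arityOf_replicate (n : ℕ) : arityOf (List.replicate n (6, [])) = n := by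
  induction n with
  | zero => rfl
  | succ n ih => simpa [List.replicate_succ, arityOf] using ih

theorem eval_replicate (x : Input) (θ : Thread) (v : List ℕ) (n : ℕ) (stk : List Bool) :
    eval x θ v (List.replicate n (6, [])) stk = stk := by
  induction n with
  | zero => rfl
  | succ n ih => simpa [List.replicate_succ, eval, evalTok] using ih

/-! ### Control states and the past of a run -/

/-- The instruction stream of core `c`. -/
def instrList (P : Program S) (c : S.Core) : List (Instr S) :=
  (P c).mapIdx fun j o => ⟨c, j, o⟩

theorem getElem?_instrList {P : Program S} {c : S.Core} {n : ℕ} {i : Instr S} :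
    (instrList P c)[n]? = some i ↔ i.core = c ∧ i.label = n ∧ i ∈ P.instrs := by
  rw [instrList, List.getElem?_mapIdx, Option.map_eq_some_iff]
  constructor
  · rintro ⟨o, ho, rfl⟩
    exact ⟨rfl, rfl, ho⟩
  · rintro ⟨rfl, rfl, h⟩
    exact ⟨i.op, h, rfl⟩

theorem getElem?_of_isPrefix {α : Type*} {l l' : List α} (h : l <+: l') {n : ℕ} {a : α}
    (ha : l[n]? = some a) : l'[n]? = some a := by
  obtain ⟨s, rfl⟩ := h
  rw [List.getElem?_append_left (List.getElem?_eq_some_iff.1 ha).1, ha]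

/-- `F` lists instructions that may have been fetched, and `τ` events that may have been scheduled,
in a run on the program `P`. -/
structure Recorded (P : Program S) (F : List (Instr S)) (τ : List (Event S)) : Prop where
  isPrefix : ∀ c, F.filter (·.core = c) <+: instrList P c
  ordered : Ordered F
  nodup : τ.Nodup
  mem : ∀ e ∈ τ, e.instr ∈ F

namespace Recorded

variable {P : Program S} {F : List (Instr S)} {τ : List (Event S)} {i : Instr S}

/-- What has been fetched on a core is a prefix of its stream, so position and label agree. -/
theorem getElem?_filter (h : Recorded P F τ) {c : S.Core} {n : ℕ} :
    (F.filter (·.core = c))[n]? = some i ↔ i ∈ F ∧ i.core = c ∧ i.label = n := by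
  have key : ∀ {n : ℕ}, (F.filter (·.core = c))[n]? = some i → i.label = n := fun {n} hn =>
    (getElem?_instrList.1 (getElem?_of_isPrefix (h.isPrefix c) hn)).2.1
  constructor
  · intro hn
    have := List.mem_filter.1 (List.mem_of_getElem? hn)
    exact ⟨this.1, by simpa using this.2, key hn⟩
  · rintro ⟨hi, hc, rfl⟩
    obtain ⟨n, hn⟩ := List.getElem?_of_mem ((List.mem_filter (p := (·.core = c))).2
      ⟨hi, by simpa using hc⟩)
    rwa [key hn]

theorem label_lt (h : Recorded P F τ) (hi : i ∈ F) : i.label < fetched F i.core := by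
  rw [fetched, List.countP_eq_length_filter]
  exact (List.getElem?_eq_some_iff.1 (h.getElem?_filter.2 ⟨hi, rfl, rfl⟩)).1

theorem mem_instrs (h : Recorded P F τ) (hi : i ∈ F) : i ∈ P.instrs :=
  (getElem?_instrList.1 (getElem?_of_isPrefix (h.isPrefix i.core)
    (h.getElem?_filter.2 ⟨hi, rfl, rfl⟩))).2.2

theorem eq_of_label_eq (h : Recorded P F τ) {j : Instr S} (hi : i ∈ F) (hj : j ∈ F)
    (hc : i.core = j.core) (hl : i.label = j.label) : i = j := by
  have hi' := h.getElem?_filter.2 ⟨hi, hc, hl⟩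
  rw [h.getElem?_filter.2 ⟨hj, rfl, rfl⟩] at hi'
  exact (Option.some.inj hi').symm

/-- Counted back from the head, the index of an instruction is its age; this links history indices
to threads. -/
theorem getElem?_reverse_filter (h : Recorded P F τ) {c : S.Core} {n : ℕ} :
    (F.filter (·.core = c)).reverse[n]? = some i ↔
      i ∈ F ∧ i.core = c ∧ fetched F c - 1 - i.label = n := by
  by_cases hn : n < (F.filter (·.core = c)).length
  · rw [List.getElem?_reverse hn, h.getElem?_filter, fetched, List.countP_eq_length_filter]
    refine and_congr_right fun hi => and_congr_right fun hc => ?_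
    have := h.label_lt hi
    rw [fetched, List.countP_eq_length_filter, hc] at this
    omega
  · rw [List.getElem?_eq_none (by simpa using hn)]
    refine iff_of_false (by simp) ?_
    rintro ⟨hi, rfl, hl⟩
    have := h.label_lt hi
    rw [fetched, List.countP_eq_length_filter] at this hl
    omega

theorem label_of_isPrefix (h : F.filter (·.core = i.core) ++ [i] <+: instrList P i.core) :
    i.label = fetched F i.core ∧ i ∈ P.instrs := by
  have : (F.filter (·.core = i.core) ++ [i])[fetched F i.core]? = some i := by
    rw [fetched, List.countP_eq_length_filter]
    simp
  exact (getElem?_instrList.1 (getElem?_of_isPrefix h this)).2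

theorem notMem_of_isPrefix (h : Recorded P F τ)
    (hi : F.filter (·.core = i.core) ++ [i] <+: instrList P i.core) : i ∉ F := fun hF =>
  (h.label_lt hF).ne (label_of_isPrefix hi).1

theorem fetch (h : Recorded P F τ)
    (hi : F.filter (·.core = i.core) ++ [i] <+: instrList P i.core) :
    Recorded P (F ++ [i]) τ where
  isPrefix c := by
    rw [List.filter_append]
    by_cases hc : i.core = c
    · subst hc
      simpa using hi
    · simpa [hc] using h.isPrefix c
  ordered := by
    refine List.pairwise_append.2 ⟨h.ordered, List.pairwise_singleton _ _, ?_⟩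
    intro a ha b hb hab
    obtain rfl := List.mem_singleton.1 hb
    rw [(label_of_isPrefix hi).1, ← hab]
    exact h.label_lt ha
  nodup := h.nodup
  mem e he := List.mem_append_left _ (h.mem e he)

theorem sched (h : Recorded P F τ) (hi : i ∈ F) {st : S.Stage} (hst : ⟨i, st⟩ ∉ τ) :
    Recorded P F (τ ++ [⟨i, st⟩]) where
  isPrefix := h.isPrefix
  ordered := h.ordered
  nodup := by
    refine List.nodup_append.2 ⟨h.nodup, List.nodup_singleton _, ?_⟩
    rintro a ha b hb rfl
    exact hst (List.mem_singleton.1 hb ▸ ha)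
  mem e he := by
    rcases List.mem_append.1 he with he | he
    · exact h.mem e he
    · obtain rfl := List.mem_singleton.1 he
      exact hi

end Recorded

/-- The control state `m` consists of the threads of all small sets of fetched instructions. -/
def Represents (x : Input) (m : List Thread) (F : List (Instr S)) (τ : List (Event S)) : Prop :=
  ∀ θ, θ ∈ m ↔ ∃ ω, ω.Sublist F ∧ ω.length ≤ x.width ∧ threadOf x.hist F τ ω = θ

theorem represents_initState (x : Input) :
    Represents x initState ([] : List (Instr S)) [] := by
  intro θ
  simp only [initState, List.mem_singleton, List.sublist_nil]
  constructor
  · rintro rfl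
    exact ⟨[], rfl, Nat.zero_le _, rfl⟩
  · rintro ⟨ω, rfl, -, rfl⟩
    rfl

/-! ### Effect of fetching and scheduling on threads -/

section Step

variable {P : Program S} {F : List (Instr S)} {τ : List (Event S)} {i : Instr S} {H : ℕ}
  {ω : List (Instr S)}

theorem fetched_append (c : S.Core) :
    fetched (F ++ [i]) c = if i.core = c then fetched F c + 1 else fetched F c := by
  unfold fetched
  rw [List.countP_append]
  by_cases h : i.core = c <;> simp [h]

theorem map_bump (h : Recorded P F τ) (hω : ω.Sublist F) :
    (threadOf H F τ ω).1.map (Pick.bump H i.core.val) = (threadOf H (F ++ [i]) τ ω).1 := by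
  simp only [threadOf, List.map_map]
  refine List.map_congr_left fun j hj => ?_
  -- As the label is below the number of fetched instructions, the truncated subtraction defining
  -- the age grows by exactly one.
  have hl := h.label_lt (hω.subset hj)
  simp only [Function.comp, Pick.bump, fetched_append]
  by_cases hc : i.core = j.core
  · rw [if_pos (by rw [hc]), if_pos hc]
    simp only [Prod.mk.injEq, true_and]
    omega
  · rw [if_neg (fun h => hc (Fin.ext h.symm)), if_neg hc]

theorem eventLog_append (hτ : ∀ e ∈ τ, e.instr ≠ i) : eventLog τ (ω ++ [i]) = eventLog τ ω := by
  refine List.filterMap_congr fun e he => ?_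
  by_cases h : e.instr ∈ ω
  · simp [h, List.idxOf_append_of_mem h]
  · simp [h, hτ e he]

/-- A sublist of `F ++ [i]` is a sublist of `F`, possibly followed by `i`; these are the two
alternatives of `Thread.fetch`. -/
theorem Represents.fetch {x : Input} {m : List Thread} (hm : Represents x m F τ)
    (h : Recorded P F τ) (hi : F.filter (·.core = i.core) ++ [i] <+: instrList P i.core) :
    Represents x (fetchAll x.width x.hist i.core.val i.op.val m) (F ++ [i]) τ := by
  have hiF := h.notMem_of_isPrefix hi
  have hτ : ∀ e ∈ τ, e.instr ≠ i := fun e he heq => hiF (heq ▸ h.mem e he)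
  have h₁ : ∀ ω : List (Instr S), ω.Sublist F → threadOf x.hist (F ++ [i]) τ ω =
      ((threadOf x.hist F τ ω).1.map (Pick.bump x.hist i.core.val), (threadOf x.hist F τ ω).2) :=
    fun ω hω => by rw [map_bump h hω]; rfl
  have h₂ : ∀ ω : List (Instr S), ω.Sublist F → threadOf x.hist (F ++ [i]) τ (ω ++ [i]) =
      ((threadOf x.hist F τ ω).1.map (Pick.bump x.hist i.core.val) ++
        [(i.core.val, i.op.val, 0)], (threadOf x.hist F τ ω).2) := fun ω hω => by
    rw [map_bump h hω]
    have hl := (Recorded.label_of_isPrefix hi).1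
    simp only [threadOf, eventLog_append hτ, List.map_append, List.map_singleton, fetched_append,
      if_true, hl]
    simp
  intro θ
  rw [fetchAll, mem_nub, List.mem_flatMap]
  constructor
  · rintro ⟨θ', hθ', hθ⟩
    obtain ⟨ω, hω, hlen, rfl⟩ := (hm _).1 hθ'
    rw [Thread.fetch, List.mem_cons] at hθ
    rcases hθ with rfl | hθ
    · exact ⟨ω, hω.trans (List.sublist_append_left _ _), hlen, h₁ ω hω⟩
    · split_ifs at hθ with hlt
      · obtain rfl := List.mem_singleton.1 hθ
        exact ⟨ω ++ [i], hω.append_right _, by simpa [threadOf] using hlt, h₂ ω hω⟩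
      · simp at hθ
  · rintro ⟨ω', hω', hlen, rfl⟩
    obtain ⟨ω, l, rfl, hω, hl⟩ := List.sublist_append_iff.1 hω'
    rcases List.sublist_singleton.1 hl with rfl | rfl
    · rw [List.append_nil] at hlen ⊢
      exact ⟨_, (hm _).2 ⟨ω, hω, hlen, rfl⟩, by simp [Thread.fetch, h₁ ω hω]⟩
    · rw [List.length_append, List.length_singleton] at hlen
      refine ⟨_, (hm _).2 ⟨ω, hω, by omega, rfl⟩, ?_⟩
      have hlt : (threadOf x.hist F τ ω).1.length < x.width := by
        simp only [threadOf, List.length_map]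
        omega
      rw [Thread.fetch, if_pos hlt, h₂ ω hω]
      simp

theorem idxOf_map_eq {α β : Type*} [BEq α] [LawfulBEq α] [BEq β] [LawfulBEq β] {f : α → β}
    {a : α} {b : β} {l : List α} (h : ∀ e ∈ l, f e = b ↔ e = a) :
    (l.map f).idxOf b = l.idxOf a := by
  induction l with
  | nil => rfl
  | cons e l ih =>
    rw [List.forall_mem_cons] at h
    rw [List.map_cons]
    by_cases he : e = a
    · rw [h.1.2 he, he, List.idxOf_cons_self, List.idxOf_cons_self]
    · rw [List.idxOf_cons_ne _ he, List.idxOf_cons_ne _ (mt h.1.1 he), ih h.2]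

/-- Below the cap ages are exact, and core and age determine a fetched instruction. At the cap
several picks could share an age, hence `n < H`. -/
theorem find_threadOf (h : Recorded P F τ) (hi : i ∈ F) (hω : ω.Sublist F) {n : ℕ}
    (hn : fetched F i.core - 1 - i.label = n) (hH : n < H) :
    (threadOf H F τ ω).find i.core.val n = ω.idxOf i := by
  rw [Thread.find, threadOf, List.map_map]
  refine idxOf_map_eq fun j hj => ?_
  have hjF := hω.subset hj
  simp only [Function.comp, Prod.mk.injEq]
  constructor
  · rintro ⟨hc, hl⟩
    have hc' : j.core = i.core := Fin.ext hc
    refine h.eq_of_label_eq hjF hi hc' ?_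
    have h₁ := h.label_lt hjF
    have h₂ := h.label_lt hi
    rw [hc'] at h₁ hl
    omega
  · rintro rfl
    exact ⟨rfl, by omega⟩

theorem fresh_threadOf (h : Recorded P F τ) (hi : i ∈ F) (hω : ω.Sublist F) {n : ℕ}
    (hn : fetched F i.core - 1 - i.label = n) (hH : n < H) {st : S.Stage} :
    (threadOf H F τ ω).fresh i.core.val n st.val = true ↔ (i ∈ ω → ⟨i, st⟩ ∉ τ) := by
  rw [Thread.fresh, find_threadOf h hi hω hn hH, threadOf]
  simp only [Bool.not_eq_true', decide_eq_false_iff_not]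
  by_cases hiω : i ∈ ω
  · simp only [mem_eventLog hiω, hiω, true_imp_iff]
  · simp only [hiω, false_imp_iff, iff_true]
    intro hmem
    simp only [eventLog, List.mem_filterMap, Option.ite_none_right_eq_some, Option.some.injEq,
      Prod.mk.injEq] at hmem
    obtain ⟨e, -, he, heq, -⟩ := hmem
    rw [← List.idxOf_lt_length_iff, heq, List.idxOf_lt_length_iff] at he
    exact hiω he

theorem sched_threadOf (h : Recorded P F τ) (hi : i ∈ F) (hω : ω.Sublist F) {n : ℕ}
    (hn : fetched F i.core - 1 - i.label = n) (hH : n < H) {st : S.Stage} :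
    (threadOf H F τ ω).sched i.core.val n st.val = threadOf H F (τ ++ [⟨i, st⟩]) ω := by
  rw [Thread.sched, find_threadOf h hi hω hn hH]
  have hlen : (threadOf H F τ ω).1.length = ω.length := by simp [threadOf]
  rw [hlen]
  by_cases hiω : i ∈ ω
  · rw [if_pos (List.idxOf_lt_length_iff.2 hiω)]
    simp [threadOf, eventLog, hiω]
  · rw [if_neg (mt List.idxOf_lt_length_iff.1 hiω)]
    simp [threadOf, eventLog, hiω]

/-- The thread with the single pick `i` detects a repeated event. It belongs to the state because
the width is at least one. -/
theorem Represents.all_fresh {x : Input} {m : List Thread} (hm : Represents x m F τ)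
    (h : Recorded P F τ) (hi : i ∈ F) {n : ℕ}
    (hn : fetched F i.core - 1 - i.label = n) (hH : n < x.hist) {st : S.Stage} :
    (m.all fun θ => θ.fresh i.core.val n st.val) = true ↔ ⟨i, st⟩ ∉ τ := by
  rw [List.all_eq_true]
  constructor
  · intro hall
    have hω : [i].Sublist F := List.singleton_sublist.2 hi
    exact (fresh_threadOf h hi hω hn hH).1
      (hall _ ((hm _).2 ⟨[i], hω, by simp [Input.width], rfl⟩)) (List.mem_singleton_self i)
  · intro hτ θ hθ
    obtain ⟨ω, hω, -, rfl⟩ := (hm _).1 hθ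
    exact (fresh_threadOf h hi hω hn hH).2 fun _ => hτ

theorem Represents.sched {x : Input} {m : List Thread} (hm : Represents x m F τ)
    (h : Recorded P F τ) (hi : i ∈ F) {n : ℕ}
    (hn : fetched F i.core - 1 - i.label = n) (hH : n < x.hist) {st : S.Stage} :
    Represents x (schedAll i.core.val n st.val m) F (τ ++ [⟨i, st⟩]) := by
  intro θ
  rw [schedAll, mem_nub, List.mem_map]
  constructor
  · rintro ⟨θ', hθ', rfl⟩
    obtain ⟨ω, hω, hlen, rfl⟩ := (hm _).1 hθ'
    exact ⟨ω, hω, hlen, (sched_threadOf h hi hω hn hH).symm⟩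
  · rintro ⟨ω, hω, hlen, rfl⟩
    exact ⟨_, (hm _).2 ⟨ω, hω, hlen, rfl⟩, sched_threadOf h hi hω hn hH⟩

end Step

/-! ### Acceptance -/

theorem complete_threadOf {D H : ℕ} (hD : D = S.numStages) {F : List (Instr S)}
    {τ : List (Event S)} {ω : List (Instr S)} (hω : ω.Nodup) :
    (threadOf H F τ ω).complete D = true ↔ ∀ i ∈ ω, ∀ st, (⟨i, st⟩ : Event S) ∈ τ := by
  subst hD
  simp only [Thread.complete, List.all_eq_true, List.mem_range, decide_eq_true_eq]
  have hlen : (threadOf H F τ ω).1.length = ω.length := by simp [threadOf]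
  rw [hlen]
  constructor
  · intro h i hi st
    exact (mem_eventLog hi).1 (h _ (List.idxOf_lt_length_iff.2 hi) _ st.2)
  · intro h j hj st hst
    have hi : ω[j] ∈ ω := List.getElem_mem hj
    have := (mem_eventLog hi).2 (h _ hi ⟨st, hst⟩)
    rwa [hω.idxOf_getElem] at this

theorem length_le_width {A : Semantics S} {t : ℕ} {ax : Ax S 0} (h : ax ∈ A.axs) :
    ax.code.length ≤ Input.width (A.code, t) := by
  have key : ∀ (l : List ℕ) (n : ℕ), n ∈ l → n ≤ l.foldr max 0 := by
    intro l n hn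
    induction l with
    | nil => simp at hn
    | cons a l ih =>
      rcases List.mem_cons.1 hn with rfl | hn
      · exact le_max_left _ _
      · exact (ih hn).trans (le_max_right _ _)
  refine (key _ _ ?_).trans (Nat.le_succ _)
  exact List.mem_map.2 ⟨ax.code, List.mem_map.2 ⟨ax, h, rfl⟩, rfl⟩

section Accept

variable {A : Semantics S} {t H : ℕ} {P : Program S} {F : List (Instr S)} {τ : List (Event S)}
  {ω : List (Instr S)}

theorem satisfies_threadOf (hτ : τ.Nodup) (hω : Ordered ω)
    (hev : ∀ i ∈ ω, ∀ st, (⟨i, st⟩ : Event S) ∈ τ) {n : ℕ} {φ : QF S n} :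
    (threadOf H F τ ω).satisfies (A.code, t) (List.replicate n (6, []) ++ φ.code) = true ↔
      ∀ s : Fin n → Instr S, Function.Injective s → (∀ m, s m ∈ ω) →
        φ.Sat A (traceGraph P τ) s := by
  classical
  have hlen : (threadOf H F τ ω).1.length = ω.length := by simp [threadOf]
  rw [Thread.satisfies, arityOf_append, arityOf_replicate, QF.arityOf_code, add_zero, hlen]
  simp only [List.all_eq_true, mem_injWords, List.mem_range, decide_eq_true_eq, eval_append,
    eval_replicate]
  constructor
  · intro h s hs hsω
    have := h (List.ofFn fun m => ω.idxOf (s m)) ⟨by simp, ?_, ?_⟩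
    · rw [eval_code (P := P) hτ hω hev hsω fun m => getD_ofFn _ 0 m] at this
      simpa using this
    · exact List.nodup_ofFn.2 fun a b hab => hs ((List.idxOf_inj (hsω a)).1 hab)
    · simp only [List.mem_ofFn, forall_exists_index, forall_apply_eq_imp_iff]
      exact fun m => List.idxOf_lt_length_iff.2 (hsω m)
  · rintro h v ⟨rfl, hv, hvω⟩
    have hlt : ∀ m : Fin v.length, v[m] < ω.length := fun m => hvω _ (List.getElem_mem _)
    rw [eval_code (P := P) (s := fun m => ω[v[m]]'(hlt m)) hτ hω hev
      (fun m => List.getElem_mem _)]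
    · simp only [List.cons.injEq, and_true, decide_eq_true_eq]
      refine h _ (fun a b hab => ?_) fun m => List.getElem_mem _
      have := (hω.nodup.getElem_inj_iff).1 hab
      exact Fin.ext ((hv.getElem_inj_iff).1 this)
    · intro m
      rw [hω.nodup.idxOf_getElem]
      simp [List.getD_eq_getElem?_getD]

/-- Threads with one pick show that every event was emitted. A tuple for an axiom with `n`
quantifiers is contained in a thread with at most `n` picks, and `n` is within the width since the
code of the axiom contains its quantifiers. Conversely, all picks are instructions of the program.
-/
theorem Represents.accepting_iff (hA : A.IsUniversal) {m : List Thread}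
    (hm : Represents (A.code, t) m F τ) (h : Recorded P F τ) (hF : ∀ i ∈ P.instrs, i ∈ F) :
    accepting (A.code, t) m = true ↔
      (∀ e, e ∈ τ ↔ e ∈ P.events) ∧ ∀ ax ∈ A.axs, A.Models P (traceGraph P τ) ax := by
  have hord : ∀ {ω : List (Instr S)}, ω.Sublist F → Ordered ω := fun hω => h.ordered.sublist hω
  have hstages : Input.stages (A.code, t) = S.numStages := rfl
  simp only [accepting, List.all_eq_true, Bool.and_eq_true]
  constructor
  · intro hacc
    have hall : ∀ i ∈ F, ∀ st, (⟨i, st⟩ : Event S) ∈ τ := fun i hi st => by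
      have hω : [i].Sublist F := List.singleton_sublist.2 hi
      have := (hacc _ ((hm _).2 ⟨[i], hω, by simp [Input.width], rfl⟩)).1
      exact (complete_threadOf hstages (hord hω).nodup).1 this i (List.mem_singleton_self i) st
    refine ⟨fun e => ⟨fun he => h.mem_instrs (h.mem e he), fun he => hall _ (hF _ he) _⟩, ?_⟩
    intro ax hax
    obtain ⟨n, φ, hc, hφ⟩ := (hA ax hax).exists_matrix_sentence
    rw [hφ]
    intro s hs hsP
    -- The values of `s`, rearranged in fetch order, form the thread on which the matrix is tested.
    have hω : (F.filter fun i => i ∈ List.ofFn s).Sublist F := List.filter_sublist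
    have hlen : (F.filter fun i => i ∈ List.ofFn s).length ≤ Input.width (A.code, t) := by
      have h₁ := ((h.ordered.nodup.filter fun i => i ∈ List.ofFn s).subperm (l₂ := List.ofFn s)
        fun i hi => by simpa using (List.mem_filter.1 hi).2).length_le
      have h₂ := length_le_width (t := t) hax
      rw [hc, List.length_append, List.length_replicate] at h₂
      rw [List.length_ofFn] at h₁
      omega
    have := (hacc _ ((hm _).2 ⟨_, hω, hlen, rfl⟩)).2 ax.code (List.mem_map.2 ⟨ax, hax, rfl⟩)
    rw [hc, satisfies_threadOf (P := P) h.nodup (hord hω) fun i hi => hall i (hω.subset hi)] at this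
    exact this s hs fun m => List.mem_filter.2 ⟨hF _ (hsP m), by simp⟩
  · rintro ⟨hmem, hax⟩ θ hθ
    obtain ⟨ω, hω, -, rfl⟩ := (hm _).1 hθ
    have hev : ∀ i ∈ ω, ∀ st, (⟨i, st⟩ : Event S) ∈ τ := fun i hi st =>
      (hmem _).2 (h.mem_instrs (hω.subset hi))
    refine ⟨(complete_threadOf hstages (hord hω).nodup).2 hev, fun c hc => ?_⟩
    obtain ⟨ax, hax', rfl⟩ := List.mem_map.1 hc
    obtain ⟨n, φ, hc, hφ⟩ := (hA ax hax').exists_matrix_sentence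
    rw [hc, satisfies_threadOf (P := P) h.nodup (hord hω) hev]
    exact fun s hs hsω => (hφ A P _).1 (hax ax hax') s hs fun m =>
      h.mem_instrs (hω.subset (hsω m))

end Accept

/-! ### The synthesized model -/

/-- What the heads read, with instructions represented by their operations. -/
def guardCode (r : S.Core → Option (Instr S)) : List (Option ℕ) :=
  List.ofFn fun c => (r c).map fun i => i.op.val

section Model

variable {A : Semantics S} {t : ℕ} {Q : List (List Thread)}

theorem guardCode_mem_guards (r : S.Core → Option (Instr S)) :
    guardCode r ∈ Input.guards (A.code, t) := by
  refine mem_guards.2 ⟨by simp only [guardCode, List.length_ofFn]; rfl, fun o ho => ?_⟩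
  obtain ⟨c, hc⟩ := (List.mem_ofFn' _ _).1 ho
  obtain ⟨i, -, rfl⟩ := Option.map_eq_some_iff.1 hc
  exact i.op.2

theorem right_mem_actions (c : S.Core) : (Act.right c).code ∈ Input.actions (A.code, t) :=
  mem_actions.2 ⟨c.val, c.2, Or.inl rfl⟩

theorem stay_notMem_actions : (Act.stay : Act S).code ∉ Input.actions (A.code, t) := by
  simp [mem_actions, Act.code]

theorem sched_mem_actions {c : S.Core} {n : ℕ} {st : S.Stage} :
    (Act.sched c n st).code ∈ Input.actions (A.code, t) ↔ n < t + 1 := by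
  rw [mem_actions]
  constructor
  · rintro ⟨_, -, h | h | ⟨n', hn', _, -, h⟩⟩
    · simp [Act.code] at h
    · simp [Act.code] at h
    · simp only [Act.code, Prod.mk.injEq, List.cons.injEq, true_and] at h
      exact h.2.1 ▸ hn'
  · intro h
    exact ⟨c.val, c.2, Or.inr (Or.inr ⟨n, h, st.val, st.2, rfl⟩)⟩

theorem drop_mem_actions {c : S.Core} {n : ℕ} :
    (Act.drop c n).code ∈ Input.actions (A.code, t) ↔ n = t := by
  rw [mem_actions]
  constructor
  · rintro ⟨_, -, h | h | ⟨n', hn', _, -, h⟩⟩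
    · simp [Act.code] at h
    · simp only [Act.code, Prod.mk.injEq, List.cons.injEq, true_and] at h
      exact h.2.1
    · simp [Act.code] at h
  · rintro rfl
    exact ⟨c.val, c.2, Or.inr (Or.inl rfl)⟩

/-- The model that is described by `modelCode`. -/
def model (A : Semantics S) (t : ℕ) (Q : List (List Thread)) : OpModel S (Fin (Q.length + 1)) where
  hist := ((t + 1 : ℕ) : ℕ∞)
  trans := {p | (p.1.val, guardCode p.2.1, p.2.2.1.val, p.2.2.2.code) ∈ (modelCode (A.code, t) Q).2}
  init := ⟨Q.idxOf initState, Nat.lt_succ_of_le List.idxOf_le_length⟩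
  final := Fin.last _
  act_mem := by
    rintro q r q' a h
    rcases mem_modelCode.1 h with ⟨m, -, -, ha, -⟩ | ⟨m, -, -, -, -, -, ha⟩
    · cases a with
      | right c => trivial
      | stay => trivial
      | sched c n st => exact Nat.cast_lt.2 (sched_mem_actions.1 ha)
      | drop c n => exact Nat.cast_lt.2 (Nat.lt_succ_of_le (drop_mem_actions.1 ha).le)
    · cases a with
      | stay => trivial
      | _ => simp [Act.code] at ha
  absorbing := by
    rintro r q' a h
    rcases mem_modelCode.1 h with ⟨m, hm, -, -, m', -, hq, -⟩ | ⟨m, hm, -, hq, -⟩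
    · exact absurd hq.symm (List.idxOf_lt_length_iff.2 hm).ne
    · exact absurd hq.symm (List.idxOf_lt_length_iff.2 hm).ne

theorem hasCode_model : (model A t Q).HasCode (modelCode (A.code, t) Q) :=
  ⟨t + 1, rfl, rfl, fun _ _ _ _ => Iff.rfl⟩

theorem step_right {m : List Thread} {r : S.Core → Option (Instr S)} {c : S.Core} :
    step (A.code, t) m (guardCode r) (Act.right c).code = (r c).map fun i =>
      fetchAll (Input.width (A.code, t)) (Input.hist (A.code, t)) c.val i.op.val m := by
  simp only [step, Act.code, if_true, List.getD_cons_zero, guardCode, getD_ofFn, Option.map_map]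
  rfl

theorem step_sched {x : Input} {m : List Thread} {r : List (Option ℕ)} {c : S.Core} {n : ℕ}
    {st : S.Stage} : step x m r (Act.sched c n st).code =
      if (m.all fun θ => θ.fresh c.val n st.val) = true then some (schedAll c.val n st.val m)
      else none := rfl

theorem step_drop {x : Input} {m : List Thread} {r : List (Option ℕ)} {c : S.Core} {n : ℕ} :
    step x m r (Act.drop c n).code = some m := rfl

theorem mem_trans_of_step (hQ : closedUnder (A.code, t) Q = true) {m m' : List Thread}
    (hm : m ∈ Q) {r : S.Core → Option (Instr S)} {a : Act S}
    (ha : a.code ∈ Input.actions (A.code, t))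
    (h : step (A.code, t) m (guardCode r) a.code = some m') : m' ∈ Q ∧
      ∀ q q' : Fin (Q.length + 1), q.val = Q.idxOf m → q'.val = Q.idxOf m' →
        (q, r, q', a) ∈ (model A t Q).trans :=
  ⟨(closedUnder_iff.1 hQ).2 m hm _ (guardCode_mem_guards r) _ ha m' h, fun _ _ hq hq' =>
    mem_modelCode.2 (Or.inl ⟨m, hm, guardCode_mem_guards r, ha, m', h, hq, hq'⟩)⟩

/-- On members of `Q` the index `Q.idxOf` is injective, so a transition from the number of `m` stems
from `m` itself. -/
theorem step_of_mem_trans (hQ : closedUnder (A.code, t) Q = true) {m : List Thread}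
    (hm : m ∈ Q) {q q' : Fin (Q.length + 1)} (hq : q.val = Q.idxOf m)
    {r : S.Core → Option (Instr S)} {a : Act S} (h : (q, r, q', a) ∈ (model A t Q).trans) :
    (a.code ∈ Input.actions (A.code, t) ∧ ∃ m' ∈ Q,
      step (A.code, t) m (guardCode r) a.code = some m' ∧ q'.val = Q.idxOf m') ∨
    (accepting (A.code, t) m = true ∧ (∀ c, r c = none) ∧ q' = (model A t Q).final ∧
      a = .stay) := by
  rcases mem_modelCode.1 h with ⟨m₁, hm₁, -, ha, m', hs, hq₁, hq'⟩ |
    ⟨m₁, hm₁, hacc, hq₁, hr, hq', ha⟩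
  · obtain rfl : m = m₁ := (List.idxOf_inj hm).1 (hq.symm.trans hq₁)
    exact Or.inl ⟨ha, m', (closedUnder_iff.1 hQ).2 m hm _ (guardCode_mem_guards r) _ ha m' hs,
      hs, hq'⟩
  · obtain rfl : m = m₁ := (List.idxOf_inj hm).1 (hq.symm.trans hq₁)
    refine Or.inr ⟨hacc, fun c => ?_, Fin.ext hq', ?_⟩
    · have : (r c).map (fun i => i.op.val) ∈ guardCode r := (List.mem_ofFn' _ _).2 ⟨c, rfl⟩
      rw [hr] at this
      simpa using List.eq_of_mem_replicate this
    · cases a with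
      | stay => rfl
      | _ => simp [Act.code] at ha

/-! ### Runs of the model -/

/-- The configuration `γ` is reached by a run on `P` that fetches `F` and emits `τ`. -/
structure Reached (P : Program S) (γ : Config S (Fin (Q.length + 1))) (F : List (Instr S))
    (τ : List (Event S)) (m : List Thread) (x : Input) : Prop where
  recorded : Recorded P F τ
  left : ∀ c, γ.U c <+: (F.filter (·.core = c)).reverse
  right : ∀ c, F.filter (·.core = c) ++ γ.V c = instrList P c
  mem : m ∈ Q
  state : γ.q.val = Q.idxOf m
  represents : Represents x m F τ

namespace Reached

variable {P : Program S} {γ : Config S (Fin (Q.length + 1))} {F : List (Instr S)}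
  {τ : List (Event S)} {m : List Thread} {x : Input}

theorem init (hQ : closedUnder x Q = true) :
    Reached P ((model A t Q).initConfig P) [] [] initState x where
  recorded := ⟨fun _ => List.nil_prefix, List.Pairwise.nil, List.nodup_nil, by simp⟩
  left _ := List.nil_prefix
  right _ := rfl
  mem := (closedUnder_iff.1 hQ).1
  state := rfl
  represents := represents_initState x

theorem core_of_right (h : Reached P γ F τ m x) {c : S.Core} {i : Instr S} {w : List (Instr S)}
    (hV : γ.V c = i :: w) : i.core = c := by
  have : i ∈ instrList P c := by
    rw [← h.right c, hV]
    simp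
  obtain ⟨n, hn⟩ := List.getElem?_of_mem this
  exact (getElem?_instrList.1 hn).1

theorem isPrefix_of_right (h : Reached P γ F τ m x) {i : Instr S} {w : List (Instr S)}
    (hV : γ.V i.core = i :: w) : F.filter (·.core = i.core) ++ [i] <+: instrList P i.core :=
  ⟨w, by rw [← h.right i.core, hV]; simp⟩

theorem fetch (h : Reached P γ F τ m x) {c : S.Core} {i : Instr S} {w : List (Instr S)}
    (hV : γ.V c = i :: w) {q' : Fin (Q.length + 1)}
    (hmem : fetchAll x.width x.hist c.val i.op.val m ∈ Q)
    (hq' : q'.val = Q.idxOf (fetchAll x.width x.hist c.val i.op.val m)) :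
    Reached P ⟨Function.update γ.U c (i :: γ.U c), q', Function.update γ.V c w⟩ (F ++ [i]) τ
      (fetchAll x.width x.hist c.val i.op.val m) x := by
  obtain rfl := h.core_of_right hV
  have hi := h.isPrefix_of_right hV
  refine ⟨h.recorded.fetch hi, fun c => ?_, fun c => ?_, hmem, hq',
    h.represents.fetch h.recorded hi⟩
  · by_cases hc : c = i.core
    · subst hc
      simpa [List.filter_append] using h.left i.core
    · simpa [hc, Ne.symm hc, List.filter_append] using h.left c
  · by_cases hc : c = i.core
    · subst hc
      simpa [List.filter_append, hV] using h.right i.core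
    · simpa [hc, Ne.symm hc, List.filter_append] using h.right c

theorem sched (h : Reached P γ F τ m x) {c : S.Core} {n : ℕ} {i : Instr S} {st : S.Stage}
    (hU : (γ.U c)[n]? = some i) (hn : n < x.hist) {q' : Fin (Q.length + 1)}
    (hf : (m.all fun θ => θ.fresh c.val n st.val) = true) (hmem : schedAll c.val n st.val m ∈ Q)
    (hq' : q'.val = Q.idxOf (schedAll c.val n st.val m)) :
    Reached P ⟨γ.U, q', γ.V⟩ F (τ ++ [⟨i, st⟩]) (schedAll c.val n st.val m) x := by
  obtain ⟨hi, rfl, hl⟩ := h.recorded.getElem?_reverse_filter.1 (getElem?_of_isPrefix (h.left c) hU)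
  exact ⟨h.recorded.sched hi ((h.represents.all_fresh h.recorded hi hl hn).1 hf), h.left, h.right,
    hmem, hq', h.represents.sched h.recorded hi hl hn⟩

/-- Removing the last entry of the history leaves a prefix of the reversed fetch list, so history
indices are still ages. -/
theorem drop (h : Reached P γ F τ m x) {c : S.Core} {n : ℕ} (hn : (γ.U c).length = n + 1)
    {q' : Fin (Q.length + 1)} (hq' : q'.val = Q.idxOf m) :
    Reached P ⟨Function.update γ.U c ((γ.U c).eraseIdx n), q', γ.V⟩ F τ m x := by
  refine ⟨h.recorded, fun c' => ?_, h.right, h.mem, hq', h.represents⟩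
  by_cases hc : c' = c
  · subst hc
    have : (γ.U c').eraseIdx n = (γ.U c').take n := by
      rw [List.eraseIdx_eq_take_drop_succ, List.drop_of_length_le hn.le, List.append_nil]
    simp only [Function.update_self, this]
    exact (List.take_prefix _ _).trans (h.left c')
  · simpa [hc] using h.left c'

end Reached

/-- The linear graph of `τ` is a valid graph of `P`. -/
structure GoodTrace (A : Semantics S) (P : Program S) (τ : List (Event S)) : Prop where
  nodup : τ.Nodup
  mem_iff : ∀ e, e ∈ τ ↔ e ∈ P.events
  models : ∀ ax ∈ A.axs, A.Models P (traceGraph P τ) ax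

variable {P : Program S}

theorem mem_of_right_nil {F : List (Instr S)} {τ : List (Event S)} {m : List Thread} {x : Input}
    {γ : Config S (Fin (Q.length + 1))} (h : Reached P γ F τ m x) {i : Instr S}
    (hi : i ∈ P.instrs) (hV : γ.V i.core = []) : i ∈ F := by
  have := h.right i.core
  rw [hV, List.append_nil] at this
  have hmem : i ∈ F.filter (·.core = i.core) := by
    rw [this]
    exact List.mem_of_getElem? (getElem?_instrList.2 ⟨rfl, rfl, hi⟩)
  exact (List.mem_filter.1 hmem).1

theorem accepting_iff_goodTrace (hA : A.IsUniversal) {F : List (Instr S)} {τ : List (Event S)}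
    {m : List Thread} {γ : Config S (Fin (Q.length + 1))}
    (h : Reached P γ F τ m (A.code, t)) (hV : ∀ c, γ.V c = []) :
    accepting (A.code, t) m = true ↔ GoodTrace A P τ := by
  rw [h.represents.accepting_iff hA h.recorded fun i hi => mem_of_right_nil h hi (hV _)]
  exact ⟨fun hh => ⟨h.recorded.nodup, hh.1, hh.2⟩, fun hh => ⟨hh.mem_iff, hh.models⟩⟩

theorem run_from_final {γ γ' : Config S (Fin (Q.length + 1))} {τ : List (Event S)}
    (h : (model A t Q).Run γ τ γ') (hγ : γ.q = (model A t Q).final) : τ = [] := by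
  cases h with
  | nil => rfl
  | cons _ γ₁ _ e τ hall hstep hrun =>
    obtain ⟨a, ha, -⟩ := hstep
    rw [hγ] at ha
    rcases mem_modelCode.1 ha with ⟨m, hm, -, -, m', -, hq, -⟩ | ⟨m, hm, -, hq, -⟩
    · exact absurd hq.symm (List.idxOf_lt_length_iff.2 hm).ne
    · exact absurd hq.symm (List.idxOf_lt_length_iff.2 hm).ne

theorem Reached.state_ne_final {F : List (Instr S)} {τ : List (Event S)} {m : List Thread}
    {x : Input} {γ : Config S (Fin (Q.length + 1))} (h : Reached P γ F τ m x) :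
    γ.q ≠ (model A t Q).final := fun hq => by
  have h₁ := h.state
  rw [hq] at h₁
  exact (List.idxOf_lt_length_iff.2 h.mem).ne h₁.symm

/-- Induction on the run, generalized to start from any reached configuration, so that each step
extends the recorded past. -/
theorem goodTrace_of_run (hQ : closedUnder (A.code, t) Q = true) (hA : A.IsUniversal)
    {γ γ' : Config S (Fin (Q.length + 1))} {τ' : List (Event S)}
    (hrun : (model A t Q).Run γ τ' γ') (hfin : γ'.q = (model A t Q).final) :
    ∀ {F : List (Instr S)} {τ : List (Event S)} {m : List Thread},
      Reached P γ F τ m (A.code, t) → GoodTrace A P (τ ++ τ') := by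
  induction hrun with
  | nil γ _ =>
    intro F τ m h
    exact absurd hfin h.state_ne_final
  | cons γ γ₁ γ' e τ' hall hstep hrun ih =>
    intro F τ m h
    obtain ⟨a, ha, heff⟩ := hstep
    obtain ⟨U₁, q₁, V₁⟩ := γ₁
    obtain ⟨U, q, V⟩ := γ
    rcases step_of_mem_trans hQ h.mem h.state ha with ⟨hact, m', hm', hs, hq'⟩ |
      ⟨hacc, hr, hq', rfl⟩
    · cases heff with
      | right c i w _ _ hV =>
        simp only [step_right] at hs
        obtain ⟨j, hj, rfl⟩ := Option.map_eq_some_iff.1 hs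
        have hV' : V c = i :: w := hV
        obtain rfl : i = j := by simpa [hV'] using hj
        exact ih hfin (h.fetch hV hm' hq')
      | stay => exact absurd hact stay_notMem_actions
      | sched c n st i _ _ hU =>
        have hn := sched_mem_actions.1 hact
        rw [step_sched] at hs
        split_ifs at hs with hf
        obtain rfl := Option.some.inj hs
        have := ih hfin (h.sched hU hn hf hm' hq')
        simpa using this
      | drop c n _ _ hU =>
        obtain rfl := drop_mem_actions.1 hact
        rw [step_drop] at hs
        obtain rfl := Option.some.inj hs
        -- Allowed configurations hold at most `t + 1` instructions per core, so a drop at index `t`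
        -- hits the last entry.
        have hle : (U c).length ≤ n + 1 := Nat.cast_le.1 (hall c)
        exact ih hfin (h.drop (le_antisymm hle hU) hq')
    · have hV : ∀ c, V c = [] := fun c => List.head?_eq_none_iff.1 (hr c)
      cases heff
      rw [run_from_final hrun hq']
      simpa using (accepting_iff_goodTrace hA h hV).1 hacc

theorem sound_model (hQ : closedUnder (A.code, t) Q = true) (hA : A.IsUniversal) :
    (model A t Q).Sound A := by
  rintro P τ ⟨γ, hrun, hfin⟩
  have h : GoodTrace A P τ := goodTrace_of_run hQ hA hrun hfin (Reached.init hQ)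
  exact ⟨traceGraph P τ, ⟨traceGraph_isHbGraph h.nodup h.mem_iff, h.models⟩,
    isLinearization_traceGraph h.nodup h.mem_iff⟩

/-! ### Completeness -/

/-- The instructions to the left of the heads are the `t + 1` most recently fetched ones. -/
def HasWindow (t : ℕ) (γ : Config S (Fin (Q.length + 1))) (F : List (Instr S)) : Prop :=
  ∀ c, γ.U c = (F.filter (·.core = c)).reverse.take (t + 1)

theorem allowed_of_length_le {γ : Config S (Fin (Q.length + 1))}
    (h : ∀ c, (γ.U c).length ≤ t + 1) : (model A t Q).Allowed γ := fun c => Nat.cast_le.2 (h c)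

theorem HasWindow.length_le {γ : Config S (Fin (Q.length + 1))} {F : List (Instr S)}
    (h : HasWindow t γ F) (c : S.Core) : (γ.U c).length ≤ t + 1 := by
  rw [h c]
  exact List.length_take_le _ _

theorem run_right (hQ : closedUnder (A.code, t) Q = true) {γ : Config S (Fin (Q.length + 1))}
    {F : List (Instr S)} {τ : List (Event S)} {m : List Thread}
    (h : Reached P γ F τ m (A.code, t)) (hlen : ∀ c, (γ.U c).length ≤ t + 1) {c : S.Core}
    {i : Instr S} {w : List (Instr S)} (hV : γ.V c = i :: w) :
    ∃ q' m', Reached P ⟨Function.update γ.U c (i :: γ.U c), q', Function.update γ.V c w⟩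
        (F ++ [i]) τ m' (A.code, t) ∧
      ∀ rest γ'', (model A t Q).Run
        ⟨Function.update γ.U c (i :: γ.U c), q', Function.update γ.V c w⟩ rest γ'' →
        (model A t Q).Run γ rest γ'' := by
  have hs : step (A.code, t) m (guardCode fun c => (γ.V c).head?) (Act.right c).code =
      some (fetchAll (Input.width (A.code, t)) (Input.hist (A.code, t)) c.val i.op.val m) := by
    rw [step_right, hV]
    rfl
  obtain ⟨hm', htr⟩ := mem_trans_of_step hQ h.mem (right_mem_actions c) hs
  refine ⟨⟨_, Nat.lt_succ_of_le List.idxOf_le_length⟩, _, h.fetch hV hm' rfl,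
    fun rest γ'' hrun => ?_⟩
  exact OpModel.Run.cons γ _ γ'' none rest (allowed_of_length_le hlen)
    ⟨.right c, htr _ _ h.state rfl, .right c i w γ.U γ.V hV⟩ hrun

/-- A full window first drops its oldest entry to make room; otherwise the head just moves. -/
theorem run_fetch (hQ : closedUnder (A.code, t) Q = true) {γ : Config S (Fin (Q.length + 1))}
    {F : List (Instr S)} {τ : List (Event S)} {m : List Thread}
    (h : Reached P γ F τ m (A.code, t)) (hw : HasWindow t γ F) {c : S.Core}
    {i : Instr S} {w : List (Instr S)} (hV : γ.V c = i :: w) :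
    ∃ γ' m', Reached P γ' (F ++ [i]) τ m' (A.code, t) ∧ HasWindow t γ' (F ++ [i]) ∧
      γ'.V = Function.update γ.V c w ∧
      ∀ rest γ'', (model A t Q).Run γ' rest γ'' → (model A t Q).Run γ rest γ'' := by
  have hic : i.core = c := h.core_of_right hV
  have hwin : ∀ (U : S.Core → List (Instr S)) (q : Fin (Q.length + 1))
      (V : S.Core → List (Instr S)), (∀ c', c' ≠ c → U c' = γ.U c') →
      U c = (F.filter (·.core = c)).reverse.take t →
      HasWindow t ⟨Function.update U c (i :: U c), q, V⟩ (F ++ [i]) := by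
    intro U q V hU hUc c'
    by_cases hc : c' = c
    · subst hc
      simp [List.filter_append, hic, hUc]
    · have hic' : i.core ≠ c' := fun h' => hc (h'.symm.trans hic)
      simpa [List.filter_append, hc, hic', hU c' hc] using hw c'
  rcases (hw.length_le c).lt_or_eq with hlt | heq
  · obtain ⟨q', m', hr, hrun⟩ := run_right hQ h hw.length_le hV
    refine ⟨_, m', hr, hwin γ.U q' _ (fun _ _ => rfl) ?_, rfl, hrun⟩
    rw [hw c, List.length_take] at hlt
    rw [hw c, List.take_of_length_le (by omega), List.take_of_length_le (by omega)]
  · have hd := h.drop heq (q' := γ.q) h.state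
    have hV' : (⟨Function.update γ.U c ((γ.U c).eraseIdx t), γ.q, γ.V⟩ :
      Config S (Fin (Q.length + 1))).V c = i :: w := hV
    obtain ⟨q', m', hr, hrun⟩ := run_right hQ hd (fun c' => by
      by_cases hc : c' = c
      · subst hc
        simp only [Function.update_self]
        exact (List.length_eraseIdx_le _ _).trans (hw.length_le c')
      · simpa [hc] using hw.length_le c') hV'
    refine ⟨_, m', hr, hwin _ q' _ (fun c' hc => Function.update_of_ne hc _ _) ?_, rfl,
      fun rest γ'' hrest => ?_⟩
    · simp only [Function.update_self]
      rw [List.eraseIdx_eq_take_drop_succ, List.drop_of_length_le heq.le, List.append_nil, hw c,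
        List.take_take, min_eq_left (Nat.le_succ t)]
    · have htr := (mem_trans_of_step hQ h.mem (r := fun c => (γ.V c).head?)
        (drop_mem_actions.2 rfl) (step_drop (c := c) (n := t))).2
      exact OpModel.Run.cons γ ⟨Function.update γ.U c ((γ.U c).eraseIdx t), γ.q, γ.V⟩ γ'' none rest
        (allowed_of_length_le hw.length_le) ⟨.drop c t, htr γ.q γ.q h.state h.state, .drop c t γ.U γ.V (by omega)⟩
        (hrun rest γ'' hrest)

/-- The model schedules the next event if its instruction is fetched, and otherwise fetches on that
core; after the last event it reads the remaining streams. Each action lowers the number of unread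
instructions plus pending events, apart from drops, which accompany a fetch. The last hypothesis is
the invariant that fetched instructions with pending events are still in the window. -/
theorem exists_run (hQ : closedUnder (A.code, t) Q = true) (hA : A.IsUniversal) (n : ℕ) :
    ∀ {γ : Config S (Fin (Q.length + 1))} {F : List (Instr S)} {τ rest : List (Event S)}
      {m : List Thread}, ∑ c, (γ.V c).length + rest.length = n →
      Reached P γ F τ m (A.code, t) → HasWindow t γ F → GoodTrace A P (τ ++ rest) →
      (∀ i₁ i₂ : Instr S, i₁.core = i₂.core → ∀ st₁ st₂ : S.Stage,
        Precedes (τ ++ rest) ⟨i₂, st₂⟩ ⟨i₁, st₁⟩ → i₂.label < i₁.label + t) →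
      (∀ e ∈ rest, fetched F e.instr.core ≤ e.instr.label + (t + 1)) →
      ∃ γ', (model A t Q).Run γ rest γ' ∧ γ'.q = (model A t Q).final := by
  induction n using Nat.strong_induction_on with
  | _ n ih =>
  intro γ F τ rest m hn h hw hgood hre hbound
  have hdec : ∀ {c : S.Core} {i : Instr S} {w : List (Instr S)}, γ.V c = i :: w →
      ∑ c', (Function.update γ.V c w c').length + rest.length < n := by
    intro c i w hV
    rw [← hn, Nat.add_lt_add_iff_right]
    refine Finset.sum_lt_sum (fun c' _ => ?_) ⟨c, Finset.mem_univ _, by simp [hV]⟩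
    by_cases hc : c' = c
    · subst hc
      simp [hV]
    · simp [hc]
  cases rest with
  | nil =>
    by_cases hV : ∀ c, γ.V c = []
    · have hacc := (accepting_iff_goodTrace hA h hV).2 (by simpa using hgood)
      refine ⟨⟨γ.U, (model A t Q).final, γ.V⟩, ?_, rfl⟩
      refine OpModel.Run.cons γ ⟨γ.U, (model A t Q).final, γ.V⟩ _ none [] (allowed_of_length_le hw.length_le)
        ⟨.stay, mem_modelCode.2 (Or.inr ⟨m, h.mem, hacc, h.state, ?_, rfl, rfl⟩), .stay _ _⟩
        (.nil _ (allowed_of_length_le hw.length_le))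
      simp only [hV, guardCode, List.head?_nil, Option.map_none, List.ofFn_const]
      rfl
    · push Not at hV
      obtain ⟨c, hc⟩ := hV
      obtain ⟨i, w, hV⟩ := List.exists_cons_of_ne_nil hc
      obtain ⟨γ', m', hr, hw', hV', hrun⟩ := run_fetch hQ h hw hV
      obtain ⟨γ'', h₁, h₂⟩ := ih _ (hV' ▸ hdec hV) rfl hr hw' hgood hre (by simp)
      exact ⟨γ'', hrun _ _ h₁, h₂⟩
  | cons e rest =>
    obtain ⟨i, st⟩ := e
    have hi : i ∈ P.instrs := (hgood.mem_iff ⟨i, st⟩).1 (by simp)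
    by_cases hF : i ∈ F
    · have hlt := h.recorded.label_lt hF
      have hle : fetched F i.core ≤ i.label + (t + 1) := hbound _ List.mem_cons_self
      have hn' : fetched F i.core - 1 - i.label < t + 1 := by omega
      have hU : (γ.U i.core)[fetched F i.core - 1 - i.label]? = some i := by
        rw [hw, List.getElem?_take_of_lt hn']
        exact h.recorded.getElem?_reverse_filter.2 ⟨hF, rfl, rfl⟩
      have hf := (h.represents.all_fresh h.recorded hF rfl hn' (st := st)).2 fun hτ =>
        (List.nodup_append.1 hgood.nodup).2.2 _ hτ _ List.mem_cons_self rfl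
      obtain ⟨hm', htr⟩ := mem_trans_of_step hQ h.mem (r := fun c => (γ.V c).head?)
        (sched_mem_actions (c := i.core) (st := st).2 hn') (step_sched.trans (if_pos hf))
      have hr := h.sched hU hn' hf hm' (q' := ⟨_, Nat.lt_succ_of_le List.idxOf_le_length⟩) rfl
      have happ : τ ++ ⟨i, st⟩ :: rest = (τ ++ [⟨i, st⟩]) ++ rest := by simp
      rw [happ] at hgood hre
      obtain ⟨γ'', h₁, h₂⟩ := ih _ (by rw [← hn]; simp) rfl hr hw hgood hre
        fun e he => hbound e (List.mem_cons_of_mem _ he)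
      exact ⟨γ'', OpModel.Run.cons γ ⟨γ.U, ⟨_, Nat.lt_succ_of_le List.idxOf_le_length⟩, γ.V⟩ γ''
        (some ⟨i, st⟩) rest (allowed_of_length_le hw.length_le)
        ⟨.sched i.core _ st, htr _ _ h.state rfl, .sched i.core _ st i γ.U γ.V hU⟩ h₁, h₂⟩
    · obtain ⟨j, w, hV⟩ := List.exists_cons_of_ne_nil fun hV => hF (mem_of_right_nil h hi hV)
      obtain ⟨γ', m', hr, hw', hV', hrun⟩ := run_fetch hQ h hw hV
      have hjc := h.core_of_right hV
      -- Otherwise the fetched prefix of the stream would already contain `i`.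
      have hle : fetched F i.core ≤ i.label := by
        by_contra hlt
        push Not at hlt
        rw [fetched, List.countP_eq_length_filter] at hlt
        have h₁ := getElem?_of_isPrefix (h.recorded.isPrefix i.core)
          (List.getElem?_eq_getElem hlt)
        rw [getElem?_instrList.2 ⟨rfl, rfl, hi⟩] at h₁
        have h₂ := List.getElem_mem hlt
        rw [← Option.some.inj h₁] at h₂
        exact hF (List.mem_filter.1 h₂).1
      obtain ⟨γ'', h₁, h₂⟩ := ih _ (hV' ▸ hdec hV) rfl hr hw' hgood hre fun e he => by
        rw [fetched_append]
        split_ifs with hc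
        · rw [← hc, hjc]
          -- Either `e` is the next event, or an event of `i` precedes `e` and the reordering bound
          -- applies. With `hle`, one more fetch on this core keeps the invariant.
          have : i.label ≤ e.instr.label + t := by
            rcases List.mem_cons.1 he with rfl | he'
            · exact Nat.le_add_right _ _
            · refine (hre e.instr i (hc.symm.trans hjc) e.stage st ?_).le
              obtain ⟨k, hk⟩ := List.getElem?_of_mem he'
              exact ⟨τ.length, τ.length + (k + 1), by omega, by simp, by
                rw [List.getElem?_append_right (by omega)]
                simpa using hk⟩
          omega
        · exact hbound e he
      exact ⟨γ'', hrun _ _ h₁, h₂⟩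

theorem tComplete_model (hQ : closedUnder (A.code, t) Q = true) (hA : A.IsUniversal)
    (hA' : A.Refinable) : (model A t Q).TComplete t A := by
  intro P G hG τ hτ hre
  have hvalid := hA'.valid_traceGraph hG hτ
  have hgood : GoodTrace A P τ :=
    ⟨hτ.1, fun e => by rw [hτ.2.1, hG.1.nodes], hvalid.2⟩
  refine exists_run hQ hA _ rfl (Reached.init hQ) (fun _ => by simp [OpModel.initConfig])
    (by simpa using hgood) (fun i₁ i₂ hc st₁ st₂ hp => ?_) fun e _ => by simp [fetched]
  -- The first clause of the reordering bound is what `exists_run` asks for.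
  have := (hre i₁ i₂ hc).1 st₁ st₂ (by simpa using hp)
  unfold diffR at this
  omega

end Model

end MuSpec

/-! ### The synthesis theorem -/

theorem mainTheorem1 :
    ∃ synth : MuSpec.SemCode × ℕ → MuSpec.ModelCode, Computable synth ∧
      ∀ (S : MuSpec.Sig) (A : MuSpec.Semantics S),
        A.IsUniversal → A.Refinable → A.Extensible → ∀ t : ℕ,
          ∃ (N : ℕ) (M : MuSpec.OpModel S (Fin N)),
            M.HasCode (synth (A.code, t)) ∧ M.FiniteState ∧ M.BoundedHistory ∧
            M.Sound A ∧ M.TComplete t A := by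
  obtain ⟨synth, hc, hsynth⟩ := MuSpec.exists_computable_modelCode
  refine ⟨synth, hc, fun S A hA hA' _ t => ?_⟩
  obtain ⟨Q, hQ, h⟩ := hsynth (A.code, t)
  exact ⟨_, MuSpec.model A t Q, h ▸ MuSpec.hasCode_model, Finite.of_fintype _,
    ENat.natCast_ne_top _, MuSpec.sound_model hQ hA, MuSpec.tComplete_model hQ hA hA'⟩
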